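/- For a real number $\alpha>0$ and a positive integer $n$, call a $0$-$1$ $n\times n$ matrix $\alpha n$-regular if it has exactly $r$ ones in every row and in every column, where $r$ is $\lfloor \alpha n\rfloor$ or $\lceil \alpha n\rceil$ (so $r=\alpha n$ if $\alpha n$ is an integer); likewise call a graph on $n$ vertices $\alpha n$-regular if all its degrees equal one such $r$. A permutation $\sigma$ of $[n]$ is contained in a matrix $A$ if $A\ge A(\sigma)$ entrywise, where $A(\sigma)_{ij}=1$ if $\sigma(i)=j$ and $A(\sigma)_{ij}=0$ otherwise; the cycles of $\sigma$ are those of its cyclic form, fixed points included. A 2-factor of a graph $G$ is a spanning subgraph of $G$ each of whose connected components is a cycle, where a single edge counts as a cycle (of length two). Let $\alpha>0$ be fixed. (a) If $n$ is sufficiently large and $A$ is an $\alpha n$-regular $0$-$1$ $n\times n$ matrix, then the number of permutations $\sigma$ contained in $A$ that have at most $\sqrt{n\ln n}$ cycles is $(1+o(1))^n\left(\frac{\alpha n}{e}\right)^n$. (b) If $n$ is sufficiently large and $G$ is an $\alpha n$-regular graph on $n$ vertices, then the number of 2-factors of $G$ with at most $\sqrt{n\ln n}$ cycles is $(1+o(1))^n\left(\frac{\alpha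 n}{e}\right)^n$. Here $o(1)$ denotes a quantity whose absolute value is at most $\delta(n)$, for some function $\delta$ with $\delta(n)\to 0$ as $n\to\infty$ that depends only on $\alpha$ (and not on $A$ or $G$). -/

import Mathlib

open Filter Topology

/-- A `0`-`1` matrix is `r`-regular if it has exactly `r` ones in every row and in every column. -/
def IsRegularZeroOne {n : ℕ} (A : Matrix (Fin n) (Fin n) ℝ) (r : ℕ) : Prop :=
  (∀ i j, A i j = 0 ∨ A i j = 1) ∧
    (∀ i, {j | A i j = 1}.ncard = r) ∧ (∀ j, {i | A i j = 1}.ncard = r)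

/-- The permutation `σ` is contained in `A`, i.e. `A ≥ A(σ)` entrywise, where `A(σ)` is the
permutation matrix with `A(σ) i j = 1` if `σ i = j` and `0` otherwise. -/
def ContainsPerm {n : ℕ} (A : Matrix (Fin n) (Fin n) ℝ) (σ : Equiv.Perm (Fin n)) : Prop :=
  ∀ i j, (σ.permMatrix ℝ) i j ≤ A i j

/-- The number of cycles in the cyclic form of `σ`. Fixed points are cycles of length one; Mathlib's
`cycleType` lists only the cycles of length at least two, so the fixed points are added. -/
def numCycles {n : ℕ} (σ : Equiv.Perm (Fin n)) : ℕ :=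
  Multiset.card σ.cycleType + (Finset.univ.filter fun i => σ i = i).card

/-- `F` is a 2-factor of `G`, where a single edge counts as a cycle of length two: a spanning
subgraph of `G` each of whose connected components is a cycle of some length `k ≥ 2`
(`SimpleGraph.cycleGraph 2` is a single edge). -/
def IsTwoFactor {n : ℕ} (G F : SimpleGraph (Fin n)) : Prop :=
  F ≤ G ∧ ∀ C : F.ConnectedComponent,
    ∃ k : ℕ, 2 ≤ k ∧ Nonempty (C.toSimpleGraph ≃g SimpleGraph.cycleGraph k)

/-- The number of permutations contained in `A` with at most `s` cycles. -/
noncomputable def numPermsFewCycles {n : ℕ} (A : Matrix (Fin n) (Fin n) ℝ) (s : ℝ) : ℕ :=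
  {σ : Equiv.Perm (Fin n) | ContainsPerm A σ ∧ (numCycles σ : ℝ) ≤ s}.ncard

/-- The number of 2-factors of `G` with at most `s` cycles; the cycles of a 2-factor are its
connected components. -/
noncomputable def numTwoFactorsFewCycles {n : ℕ} (G : SimpleGraph (Fin n)) (s : ℝ) : ℕ :=
  {F : SimpleGraph (Fin n) | IsTwoFactor G F ∧ (Nat.card F.ConnectedComponent : ℝ) ≤ s}.ncard

/-! Write r for the common degree and s = √(n ln n). Up to a factor e^{o(n)}, a regular relation
contains (r/e)^n permutations. The upper bound is Brégman's theorem, `log_card_equivsIn_le`. The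
lower bound, `pow_mul_exp_neg_le_card_perm`, holds because a doubly stochastic matrix has permanent
at least e^{-n}, which Gurvits' capacity of stable polynomials proves. Since r differs from αn by at
most 1, what remains is that permutations with few cycles are not a negligible share.

With m about 2n/s, at most s/2 cycles are longer than m, so a permutation with more than s cycles
has at least s/2 short ones. Peel short cycles off one at a time (`mul_card_permsManyShort_le`). A
cycle of length l+1 through a given vertex can be traversed in at most r^l ways, because its last
step is forced, while its removal lowers the budget r^|U| by r^(l+1). Summing over vertices and
lengths and dividing by the number of short cycles available, each peel gains a factor O(nm/(rs)) =
O(1/ln n) for fixed α. After ⌈ln n⌉ peels only O(s) vertices are gone, and Brégman's theorem on the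
remaining set U (`card_permsOn_le`) still gives r^|U| e^{-n} up to a factor e^{O(ln n)}, because
s²/n = ln n. A gain of (C/ln n)^{ln n} beats any such factor, so at least half of (r/e)^n survives
(`eventually_half_le_card_fewCycles`). This is (a).

For (b), a permutation moving every vertex to a neighbour traces a 2-factor with the same number of
cycles. Every 2-factor arises in this way (`exists_perm_of_components_cycles`), and one with c
cycles arises at most 2^c times (`card_perm_of_permGraph_eq_le`). For c ≤ s this multiplicity is
e^{o(n)}, so (b) follows from the counts behind (a). -/

/-! ### Brégman's upper bound. -/

/-- The logarithm of `(d!) ^ (1 / d)`. -/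
noncomputable def logFactorialRoot (d : ℕ) : ℝ := Real.log (d.factorial) / d

lemma nat_mul_logFactorialRoot (d : ℕ) : d * logFactorialRoot d = Real.log d.factorial := by
  unfold logFactorialRoot
  rcases Nat.eq_zero_or_pos d with rfl | h
  · simp
  · field_simp

/-- Jensen's inequality for `x log x`, in the form used by Schrijver. -/
lemma sum_mul_log_sum_le {κ : Type*} (s : Finset κ) (t : κ → ℝ) (ht : ∀ k ∈ s, 0 ≤ t k) :
    (∑ k ∈ s, t k) * Real.log (∑ k ∈ s, t k) ≤
      (∑ k ∈ s, t k) * Real.log s.card + ∑ k ∈ s, t k * Real.log (t k) := by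
  rcases s.eq_empty_or_nonempty with rfl | hs
  · simp
  have hc : (0 : ℝ) < s.card := by exact_mod_cast hs.card_pos
  have hJ := Real.convexOn_mul_log.map_sum_le (t := s) (w := fun _ => (s.card : ℝ)⁻¹) (p := t)
    (fun _ _ => by positivity) (by simp [hc.ne']) (fun k hk => ht k hk)
  simp only [smul_eq_mul, ← Finset.mul_sum] at hJ
  rcases (Finset.sum_nonneg ht).eq_or_lt with h0 | h0
  · have : ∀ k ∈ s, t k = 0 := (Finset.sum_eq_zero_iff_of_nonneg ht).1 h0.symm
    rw [← h0, Finset.sum_congr rfl (fun k hk => by rw [this k hk])]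
    simp
  · rw [Real.log_mul (by positivity) h0.ne', Real.log_inv] at hJ
    have := mul_le_mul_of_nonneg_left hJ hc.le
    rw [← mul_assoc, ← mul_assoc, ← mul_assoc, mul_inv_cancel₀ hc.ne'] at this
    linarith

open Classical in
/-- The bijections `e` with `e i ∈ N i` for all `i`. -/
noncomputable def equivsIn {ι κ : Type*} [Fintype ι] [Fintype κ] (N : ι → Finset κ) :
    Finset (ι ≃ κ) := Finset.univ.filter fun e => ∀ i, e i ∈ N i

-- Restricting e to the complement of i expands the count along row i. This is the minor to which
-- the induction in Brégman's theorem applies.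
open Classical in
lemma card_equivsIn_apply_eq_le {ι κ : Type*} [Fintype ι] [Fintype κ] (N : ι → Finset κ)
    (i : ι) (k : κ) :
    ((equivsIn N).filter fun e => e i = k).card ≤
      (equivsIn fun j : {j // j ≠ i} => (N j).subtype (· ≠ k)).card := by
  -- The swap makes the restriction a map defined for every e; it is trivial on those with e i = k.
  refine Finset.card_le_card_of_injOn
    (fun e => (e.trans (Equiv.swap (e i) k)).subtypeEquiv (p := (· ≠ i)) (q := (· ≠ k))
      (fun a => by
        rw [Ne, Ne, ← (e.trans (Equiv.swap (e i) k)).injective.eq_iff (b := i)]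
        simp)) ?_ ?_
  · intro e he
    simp only [equivsIn, Finset.coe_filter, Finset.mem_filter, Finset.mem_univ, true_and,
      Set.mem_ofPred_eq] at he
    simp [equivsIn, he.1, he.2]
  · intro e he e' he' heq
    simp only [Finset.coe_filter, Set.mem_ofPred_eq] at he he'
    ext a
    by_cases ha : a = i
    · rw [ha, he.2, he'.2]
    · have := congrArg (fun f => (f ⟨a, ha⟩ : κ)) heq
      simpa [he.2, he'.2] using this

/-- **Brégman's theorem**, in logarithmic form, with Schrijver's proof. -/
theorem log_card_equivsIn_le (n : ℕ) : ∀ {ι κ : Type} [Fintype ι] [Fintype κ]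
    (N : ι → Finset κ), Fintype.card ι = n → (equivsIn N).Nonempty →
    Real.log (equivsIn N).card ≤ ∑ i, logFactorialRoot (N i).card := by
  classical
  induction n with
  | zero =>
    intro ι κ _ _ N hn hne
    have : IsEmpty ι := Fintype.card_eq_zero_iff.1 hn
    have h1 : (equivsIn N).card ≤ 1 := Finset.card_le_one.2 fun e _ e' _ => by
      ext a; exact this.elim a
    have h2 : (equivsIn N).card = 1 := le_antisymm h1 hne.card_pos
    simp [h2]
  | succ n ih =>
    intro ι κ _ _ N hn hne
    set P := equivsIn N with hP
    set t : ι → κ → ℝ := fun i k => ((P.filter fun e => e i = k).card : ℝ) with ht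
    have memP : ∀ e ∈ P, ∀ i, e i ∈ N i := fun e he => by simpa [hP, equivsIn] using he
    have hpos : (0 : ℝ) < P.card := by exact_mod_cast hne.card_pos
    have hsum : ∀ i, ∑ k ∈ N i, t i k = P.card := fun i => by
      rw [Finset.card_eq_sum_card_fiberwise (f := fun e => e i) (t := N i)
        (fun e he => memP e he i)]
      push_cast; rfl
    have hsum' : ∀ i, ∀ g : κ → ℝ, ∑ k ∈ N i, t i k * g k = ∑ e ∈ P, g (e i) := fun i g => by
      rw [← Finset.sum_fiberwise_of_maps_to (s := P) (t := N i) (g := fun e => e i)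
        (fun e he => memP e he i)]
      refine Finset.sum_congr rfl fun k _ => ?_
      rw [Finset.sum_congr rfl (g := fun _ => g k) (fun e he => by
        rw [(Finset.mem_filter.1 he).2]), Finset.sum_const, nsmul_eq_mul]
    -- Schrijver's device: convexity along row i, with the weighted sum over columns rewritten as an
    -- average over the bijections themselves.
    have hrow : ∀ i, (P.card : ℝ) * Real.log P.card ≤
        ∑ e ∈ P, (Real.log (N i).card + Real.log (t i (e i))) := fun i => by
      have := sum_mul_log_sum_le (N i) (t i) (fun k _ => Nat.cast_nonneg _)
      rw [hsum i, hsum' i] at this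
      rw [Finset.sum_add_distrib, Finset.sum_const, nsmul_eq_mul]
      exact this
    have hminor : ∀ e ∈ P, ∀ i, Real.log (t i (e i)) ≤
        ∑ j ∈ Finset.univ.erase i, logFactorialRoot ((N j).erase (e i)).card := fun e he i => by
      set N' := fun j : {j // j ≠ i} => (N j).subtype (· ≠ e i) with hN'
      have hle := card_equivsIn_apply_eq_le N i (e i)
      have hp : 0 < (P.filter fun e' => e' i = e i).card :=
        Finset.card_pos.2 ⟨e, Finset.mem_filter.2 ⟨he, rfl⟩⟩
      have h1 : Real.log (t i (e i)) ≤ Real.log (equivsIn N').card :=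
        Real.log_le_log (Nat.cast_pos.2 hp) (Nat.cast_le.2 hle)
      refine h1.trans ((ih N' (by simp [Fintype.card_subtype_compl, hn]) (Finset.card_pos.1
        (lt_of_lt_of_le hp hle))).trans (le_of_eq ?_))
      rw [Finset.sum_subtype (Finset.univ.erase i) (p := (· ≠ i)) (by simp)
        (fun j => logFactorialRoot ((N j).erase (e i)).card)]
      refine Finset.sum_congr rfl fun j _ => ?_
      rw [hN', Finset.card_subtype, Finset.filter_ne']
    -- Let d + 1 be the size of N j. As e is a bijection with e j ∈ N j, exactly d of the n indices
    -- i ≠ j delete an element of N j. So the sum is log (d+1) + log d! + (n - d) times the root of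
    -- size d + 1, and log (d+1)! is d + 1 further copies of that root.
    have hcol : ∀ e ∈ P, ∀ j, Real.log (N j).card +
        ∑ i ∈ Finset.univ.erase j, logFactorialRoot ((N j).erase (e i)).card
          = (n + 1) * logFactorialRoot (N j).card := fun e he j => by
      obtain ⟨d, hd⟩ : ∃ d, (N j).card = d + 1 :=
        Nat.exists_eq_succ_of_ne_zero (Finset.card_ne_zero_of_mem (memP e he j))
      have hcards : ((Finset.univ.erase j).filter fun i => e i ∈ N j).card = d := by
        have : (Finset.univ.filter fun i => e i ∈ N j).card = d + 1 := by
          rw [← hd, ← Finset.card_map e.symm.toEmbedding]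
          congr 1
          ext i; simp
        rw [Finset.filter_erase, Finset.card_erase_of_mem (by simp [memP e he j]), this]
        rfl
      have hcards' : ((Finset.univ.erase j).filter fun i => ¬ e i ∈ N j).card + d = n := by
        have := Finset.card_filter_add_card_filter_not (s := Finset.univ.erase j)
          (fun i => e i ∈ N j)
        rw [Finset.card_erase_of_mem (Finset.mem_univ _), Finset.card_univ, hn, hcards] at this
        omega
      rw [← Finset.sum_filter_add_sum_filter_not _ (fun i => e i ∈ N j),
        Finset.sum_congr rfl (g := fun _ => logFactorialRoot d) (fun i hi => by
          rw [Finset.card_erase_of_mem (Finset.mem_filter.1 hi).2, hd, Nat.add_sub_cancel]),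
        Finset.sum_congr (s₁ := Finset.filter (fun i => ¬ e i ∈ N j) _) rfl
          (g := fun _ => logFactorialRoot (d + 1)) (fun i hi => by
          rw [Finset.erase_eq_of_notMem (Finset.mem_filter.1 hi).2, hd]),
        Finset.sum_const, Finset.sum_const, hcards, nsmul_eq_mul, nsmul_eq_mul,
        nat_mul_logFactorialRoot, hd]
      have h2 := nat_mul_logFactorialRoot (d + 1)
      rw [Nat.factorial_succ, Nat.cast_mul, Real.log_mul (by positivity) (by positivity)] at h2
      rw [← hcards']
      push_cast at h2 ⊢
      linarith
    have hmain : ((n : ℝ) + 1) * (P.card * Real.log P.card) ≤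
        P.card * ((n + 1) * ∑ i, logFactorialRoot (N i).card) := by
      calc ((n : ℝ) + 1) * (P.card * Real.log P.card)
          = ∑ _i : ι, (P.card : ℝ) * Real.log P.card := by simp [hn]
        _ ≤ ∑ i, ∑ e ∈ P, (Real.log (N i).card + Real.log (t i (e i))) :=
          Finset.sum_le_sum fun i _ => hrow i
        _ = ∑ e ∈ P, ∑ i, (Real.log (N i).card + Real.log (t i (e i))) := Finset.sum_comm
        _ ≤ ∑ e ∈ P, ∑ i, (n + 1) * logFactorialRoot (N i).card := by
          refine Finset.sum_le_sum fun e he => ?_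
          calc _ ≤ ∑ i, (Real.log (N i).card + ∑ j ∈ Finset.univ.erase i,
                logFactorialRoot ((N j).erase (e i)).card) :=
                Finset.sum_le_sum fun i _ => by linarith [hminor e he i]
            _ = ∑ j, (Real.log (N j).card + ∑ i ∈ Finset.univ.erase j,
                logFactorialRoot ((N j).erase (e i)).card) := by
                rw [Finset.sum_add_distrib, Finset.sum_add_distrib]
                congr 1
                exact Finset.sum_comm' fun i j => by simp [eq_comm]
            _ = _ := Finset.sum_congr rfl fun j _ => hcol e he j
        _ = _ := by rw [Finset.sum_const, nsmul_eq_mul, ← Finset.mul_sum]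
    have h3 : P.card * (((n : ℝ) + 1) * Real.log P.card) ≤
        P.card * ((n + 1) * ∑ i, logFactorialRoot (N i).card) := by linarith
    exact le_of_mul_le_mul_left (le_of_mul_le_mul_left h3 hpos) (by positivity)

/-! ### Stable polynomials, capacity and permanents. -/

/-- A polynomial with nonpositive real roots grows at most like the exponential with the same
logarithmic derivative at `0`. -/
lemma norm_eval_le_exp_of_roots_nonpos (f : Polynomial ℂ) (hr : ∀ ρ ∈ f.roots, ρ = -(‖ρ‖ : ℂ))
    (h0 : f.eval 0 ≠ 0) (t : ℝ) (ht : 0 ≤ t) :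
    ‖f.eval (t : ℂ)‖ ≤ ‖f.eval 0‖ * Real.exp (t * (‖f.coeff 1‖ / ‖f.eval 0‖)) := by
  have hs : f.Splits := IsAlgClosed.splits f
  have hne : ∀ ρ ∈ f.roots, ρ ≠ 0 := by
    rintro ρ hρ rfl
    exact h0 (Polynomial.isRoot_of_mem_roots hρ)
  set S : ℝ := (f.roots.map fun ρ => 1 / ‖ρ‖).sum with hS
  have hSnn : 0 ≤ S := Multiset.sum_nonneg fun a ha => by
    obtain ⟨ρ, -, rfl⟩ := Multiset.mem_map.1 ha
    positivity
  -- The logarithmic derivative at 0 is the sum of 1/(0 - ρ), whose terms are positive reals.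
  have hderiv : ‖f.coeff 1‖ / ‖f.eval 0‖ = S := by
    have h1 := hs.eval_derivative_div_eval_of_ne_zero h0
    have h2 : f.derivative.eval 0 = f.coeff 1 := by
      rw [← Polynomial.coeff_zero_eq_eval_zero, Polynomial.coeff_derivative]; simp
    have h3 : (f.roots.map fun z => 1 / (0 - z)).sum = (S : ℂ) := by
      rw [hS, ← Complex.ofRealHom_eq_coe, map_multiset_sum, Multiset.map_map]
      refine congrArg _ (Multiset.map_congr rfl fun ρ hρ => ?_)
      conv_lhs => rw [hr ρ hρ]
      simp
    rw [h2, h3] at h1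
    rw [← norm_div, h1, Complex.norm_real, Real.norm_of_nonneg hSnn]
  have hnorm : ∀ x : ℂ, ‖f.eval x‖ = ‖f.leadingCoeff‖ * (f.roots.map fun ρ => ‖x - ρ‖).prod := by
    intro x
    rw [hs.eval_eq_prod_roots, norm_mul]
    congr 1
    have := map_multiset_prod (normHom : ℂ →*₀ ℝ) (f.roots.map (x - ·))
    rw [Multiset.map_map] at this
    exact this
  rw [hderiv, hnorm, hnorm, mul_assoc]
  refine mul_le_mul_of_nonneg_left ?_ (norm_nonneg _)
  have hexp : Real.exp (t * S) = (f.roots.map fun ρ => Real.exp (t * (1 / ‖ρ‖))).prod := by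
    rw [hS, ← Multiset.sum_map_mul_left, Real.exp_multiset_sum, Multiset.map_map]
    rfl
  rw [hexp, ← Multiset.prod_map_mul]
  refine Multiset.prod_map_le_prod_map₀ _ _ (fun _ _ => norm_nonneg _) fun ρ hρ => ?_
  have hpos : 0 < ‖ρ‖ := norm_pos_iff.2 (hne ρ hρ)
  have h1 : ‖(t : ℂ) - ρ‖ = t + ‖ρ‖ := by
    conv_lhs => rw [hr ρ hρ]
    rw [sub_neg_eq_add, ← Complex.ofReal_add, Complex.norm_real,
      Real.norm_of_nonneg (by positivity)]
  rw [h1, zero_sub, norm_neg]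
  have h2 := Real.add_one_le_exp (t * (1 / ‖ρ‖))
  calc t + ‖ρ‖ = ‖ρ‖ * (t * (1 / ‖ρ‖) + 1) := by field_simp
    _ ≤ _ := mul_le_mul_of_nonneg_left h2 hpos.le

namespace MvPolynomial

/-- Stability in the closed right half-space, its boundary of purely imaginary points excluded. -/
def IsRightStable {n : ℕ} (p : MvPolynomial (Fin n) ℂ) : Prop :=
  ∀ z : Fin n → ℂ, (∀ i, 0 ≤ (z i).re) → (∃ i, 0 < (z i).re) → eval z p ≠ 0

lemma IsHomogeneous.eval_mul {n d : ℕ} {p : MvPolynomial (Fin n) ℂ} (hp : p.IsHomogeneous d)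
    (c : ℂ) (z : Fin n → ℂ) : eval (fun i => c * z i) p = c ^ d * eval z p := by
  rw [eval_eq', eval_eq', Finset.mul_sum]
  refine Finset.sum_congr rfl fun m hm => ?_
  have hd : ∑ i, m i = d := by
    rw [← Finsupp.degree_eq_sum]
    by_contra h
    exact (mem_support_iff.1 hm) (hp.coeff_eq_zero h)
  simp_rw [mul_pow]
  rw [Finset.prod_mul_distrib, Finset.prod_pow_eq_pow_sum, hd]
  ring

/-- The restriction of `p` to the line of points `(t, z)`. -/
noncomputable def restrictFirst {n : ℕ} (p : MvPolynomial (Fin (n + 1)) ℂ) (z : Fin n → ℂ) :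
    Polynomial ℂ := Polynomial.map (eval z) (finSuccEquiv ℂ n p)

lemma eval_restrictFirst {n : ℕ} (p : MvPolynomial (Fin (n + 1)) ℂ) (z : Fin n → ℂ) (t : ℂ) :
    (p.restrictFirst z).eval t = eval (Fin.cons t z : Fin (n + 1) → ℂ) p :=
  (eval_eq_eval_mv_eval' z t p).symm

lemma coeff_restrictFirst {n : ℕ} (p : MvPolynomial (Fin (n + 1)) ℂ) (z : Fin n → ℂ) (k : ℕ) :
    (p.restrictFirst z).coeff k = eval z ((finSuccEquiv ℂ n p).coeff k) :=
  Polynomial.coeff_map _ _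

variable {n : ℕ} {p : MvPolynomial (Fin (n + 1)) ℂ}

lemma IsRightStable.eval_cons_ne_zero (hp : p.IsRightStable) {z : Fin n → ℂ}
    (hz : ∀ i, 0 ≤ (z i).re) (hz' : ∃ i, 0 < (z i).re) {t : ℂ} (ht : 0 ≤ t.re) :
    eval (Fin.cons t z : Fin (n + 1) → ℂ) p ≠ 0 :=
  hp _ (fun i => Fin.cases (by simpa using ht) (fun j => by simpa using hz j) i)
    (hz'.elim fun i hi => ⟨i.succ, by simpa using hi⟩)

lemma restrictFirst_roots_re_neg (hp : p.IsRightStable) {z : Fin n → ℂ}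
    (hz : ∀ i, 0 ≤ (z i).re) (hz' : ∃ i, 0 < (z i).re) {ρ : ℂ}
    (hρ : ρ ∈ (p.restrictFirst z).roots) : ρ.re < 0 := by
  by_contra! h
  refine hp.eval_cons_ne_zero hz hz' h ?_
  rw [← eval_restrictFirst]
  exact Polynomial.isRoot_of_mem_roots hρ

/-- Without roots, p would be constant along the line (t, z). Homogeneity then gives p(1, εz) =
ε^(n+1) p(0, z), and ε → 0 makes p vanish at (1, 0), against stability. -/
lemma restrictFirst_roots_ne_zero (hp : p.IsRightStable) (hh : p.IsHomogeneous (n + 1))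
    (z : Fin n → ℂ) : (p.restrictFirst z).roots ≠ 0 := by
  intro hroots
  have hconst : ∀ t, (p.restrictFirst z).eval t = (p.restrictFirst z).eval 0 := by
    intro t
    rw [(IsAlgClosed.splits (p.restrictFirst z)).eval_eq_prod_roots,
      (IsAlgClosed.splits (p.restrictFirst z)).eval_eq_prod_roots, hroots]
    simp
  have key : ∀ ε : ℂ, ε ≠ 0 → eval (Fin.cons 1 (fun i => ε * z i) : Fin (n + 1) → ℂ) p =
      ε ^ (n + 1) * (p.restrictFirst z).eval 0 := by
    intro ε hε
    rw [← hconst ε⁻¹, eval_restrictFirst, ← hh.eval_mul]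
    congr 2
    funext i
    refine Fin.cases ?_ (fun j => ?_) i
    · simp [hε]
    · simp
  have hc : Continuous fun ε : ℂ =>
      eval (Fin.cons 1 (fun i => ε * z i) : Fin (n + 1) → ℂ) p := by
    refine (MvPolynomial.continuous_eval p).comp (continuous_pi fun i => ?_)
    refine Fin.cases ?_ (fun j => ?_) i
    · simpa using continuous_const
    · simp only [Fin.cons_succ]; fun_prop
  have hc' : Continuous fun ε : ℂ => ε ^ (n + 1) * (p.restrictFirst z).eval 0 := by fun_prop
  have heq : (fun ε : ℂ => eval (Fin.cons 1 (fun i => ε * z i) : Fin (n + 1) → ℂ) p) =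
      fun ε : ℂ => ε ^ (n + 1) * (p.restrictFirst z).eval 0 :=
    Continuous.ext_on (s := {0}ᶜ) (dense_compl_singleton 0) hc hc' (fun ε hε => key ε hε)
  have := congrFun heq 0
  simp only [zero_mul, ne_eq, Nat.succ_ne_zero, not_false_eq_true, zero_pow] at this
  refine hp _ (fun i => ?_) ⟨0, ?_⟩ this
  · refine Fin.cases ?_ (fun j => ?_) i <;> simp
  · simp

/-- A Gauss–Lucas argument: the ratio of the linear to the constant coefficient is the sum of -1/ρ
over the roots. All roots lie in the open left half-plane and there is at least one, so the sum has
positive real part. -/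
lemma IsRightStable.coeff_one (hp : p.IsRightStable) (hh : p.IsHomogeneous (n + 1)) :
    ((finSuccEquiv ℂ n p).coeff 1).IsRightStable := by
  intro z hz hz' h
  set f := p.restrictFirst z with hf
  have h0 : f.eval 0 ≠ 0 := by
    rw [hf, eval_restrictFirst]
    exact hp.eval_cons_ne_zero hz hz' (by simp)
  have h1 := (IsAlgClosed.splits f).eval_derivative_div_eval_of_ne_zero h0
  have h2 : f.derivative.eval 0 = f.coeff 1 := by
    rw [← Polynomial.coeff_zero_eq_eval_zero, Polynomial.coeff_derivative]; simp
  rw [h2, hf, coeff_restrictFirst, h, zero_div] at h1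
  have h3 := congrArg Complex.reAddGroupHom h1
  rw [map_zero, map_multiset_sum, Multiset.map_map] at h3
  have hpos : 0 < (f.roots.map (Complex.reAddGroupHom ∘ fun z => 1 / (0 - z))).sum := by
    rw [← Multiset.sum_map_zero (m := f.roots)]
    refine Multiset.sum_lt_sum_of_nonempty (restrictFirst_roots_ne_zero hp hh z) fun ρ hρ => ?_
    have hre := restrictFirst_roots_re_neg hp hz hz' hρ
    have hρ0 : ρ ≠ 0 := by rintro rfl; simp at hre
    simp only [Function.comp, Complex.coe_reAddGroupHom, zero_sub, one_div, Complex.inv_re,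
      Complex.neg_re]
    exact div_pos (by linarith) (Complex.normSq_pos.2 (neg_ne_zero.2 hρ0))
  exact hpos.ne h3

lemma restrictFirst_roots_eq_neg_norm (hp : p.IsRightStable) (hh : p.IsHomogeneous (n + 1))
    {x : Fin n → ℝ} (hx : ∀ i, 0 < x i) (hn : 0 < n) {ρ : ℂ}
    (hρ : ρ ∈ (p.restrictFirst fun i => (x i : ℂ)).roots) : ρ = -(‖ρ‖ : ℂ) := by
  have hre : ρ.re < 0 := restrictFirst_roots_re_neg hp (fun i => by simpa using (hx i).le)
    ⟨⟨0, hn⟩, by simpa using hx _⟩ hρ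
  have him : ρ.im = 0 := by
    by_contra him
    have hroot : eval (Fin.cons ρ (fun i => (x i : ℂ)) : Fin (n + 1) → ℂ) p = 0 := by
      rw [← eval_restrictFirst]
      exact Polynomial.isRoot_of_mem_roots hρ
    have hsq : 0 < ρ.im ^ 2 := by positivity
    -- This multiplier puts ρ on the imaginary axis and keeps the positive x i in the open right
    -- half-plane. By homogeneity the rotated point is still a zero, which stability forbids.
    refine hp (fun i => (⟨ρ.im ^ 2, ρ.re * ρ.im⟩ : ℂ) *
      (Fin.cons ρ (fun i => (x i : ℂ)) : Fin (n + 1) → ℂ) i) (fun i => ?_)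
      ⟨(⟨0, hn⟩ : Fin n).succ, ?_⟩ ?_
    · refine Fin.cases ?_ (fun j => ?_) i
      · simp only [Fin.cons_zero, Complex.mul_re]
        exact le_of_eq (by ring)
      · simp only [Fin.cons_succ, Complex.mul_re, Complex.ofReal_re, Complex.ofReal_im]
        nlinarith [hx j]
    · simp only [Fin.cons_succ, Complex.mul_re, Complex.ofReal_re, Complex.ofReal_im]
      nlinarith [hx ⟨0, hn⟩]
    · rw [hh.eval_mul, hroot, mul_zero]
  have : ‖ρ‖ = -ρ.re := by
    rw [← abs_of_neg hre]
    exact (Complex.abs_re_eq_norm.2 him).symm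
  rw [this]
  apply Complex.ext <;> simp [him]

/-- One step of Gurvits' capacity argument: passing to the linear coefficient in the first variable
loses at most a factor `e` in the capacity. -/
lemma capacity_coeff_one (hp : p.IsRightStable) (hh : p.IsHomogeneous (n + 1)) {c : ℝ}
    (hc : ∀ x : Fin (n + 1) → ℝ, (∀ i, 0 < x i) → c * ∏ i, x i ≤ ‖eval (fun i => (x i : ℂ)) p‖)
    (x : Fin n → ℝ) (hx : ∀ i, 0 < x i) :
    c * Real.exp (-1) * ∏ i, x i ≤ ‖eval (fun i => (x i : ℂ)) ((finSuccEquiv ℂ n p).coeff 1)‖ := by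
  have hcons : ∀ t : ℝ, 0 < t → c * (t * ∏ i, x i) ≤
      ‖(p.restrictFirst fun i => (x i : ℂ)).eval (t : ℂ)‖ := by
    intro t ht
    have := hc (Fin.cons t x) (fun i => Fin.cases (by simpa using ht) (fun j => by simpa using hx j) i)
    rw [Fin.prod_univ_succ] at this
    simp only [Fin.cons_zero, Fin.cons_succ] at this
    rw [eval_restrictFirst]
    convert this using 4
    funext i
    refine Fin.cases ?_ (fun j => ?_) i <;> simp
  rw [← coeff_restrictFirst]
  set f := p.restrictFirst fun i => (x i : ℂ) with hf
  -- With no other variable there is no positive coordinate for stability at t = 0, but then f is a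
  -- multiple of t.
  rcases Nat.eq_zero_or_pos n with rfl | hn
  · have h1 : f.coeff 1 = f.eval 1 := by
      have hX : f = Polynomial.C (f.eval 1) * Polynomial.X := by
        refine Polynomial.funext fun t => ?_
        rw [Polynomial.eval_mul, Polynomial.eval_C, Polynomial.eval_X, hf, eval_restrictFirst,
          eval_restrictFirst, mul_comm]
        have := hh.eval_mul t (Fin.cons 1 fun i => (x i : ℂ))
        rw [show t ^ (0 + 1) = t by ring] at this
        rw [← this]
        congr 2
        funext i
        refine Fin.cases ?_ (fun j => j.elim0) i
        simp
      conv_lhs => rw [hX]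
      simp
    have h2 := hcons 1 one_pos
    rw [h1]
    simp only [Complex.ofReal_one, Finset.univ_eq_empty, Finset.prod_empty, mul_one] at h2 ⊢
    rcases le_or_gt 0 c with h | h
    · exact (mul_le_of_le_one_right h (Real.exp_le_one_iff.2 (by norm_num))).trans h2
    · exact (mul_nonpos_of_nonpos_of_nonneg h.le (Real.exp_pos _).le).trans (norm_nonneg _)
  · have hz' : ∃ i : Fin n, 0 < ((x i : ℂ)).re := ⟨⟨0, hn⟩, by simpa using hx _⟩
    have hz : ∀ i : Fin n, 0 ≤ ((x i : ℂ)).re := fun i => by simpa using (hx i).le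
    have h0 : f.eval 0 ≠ 0 := by
      rw [hf, eval_restrictFirst]
      exact hp.eval_cons_ne_zero hz hz' (by simp)
    have h1 : f.coeff 1 ≠ 0 := by
      rw [hf, coeff_restrictFirst]
      exact hp.coeff_one hh _ hz hz'
    have h0' : 0 < ‖f.eval 0‖ := norm_pos_iff.2 h0
    have h1' : 0 < ‖f.coeff 1‖ := norm_pos_iff.2 h1
    -- This t makes the exponent in the exponential bound equal to 1, which is the source of the
    -- factor e.
    set t := ‖f.eval 0‖ / ‖f.coeff 1‖ with ht
    have htpos : 0 < t := div_pos h0' h1'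
    have h2 := norm_eval_le_exp_of_roots_nonpos f
      (fun ρ hρ => restrictFirst_roots_eq_neg_norm hp hh hx hn hρ) h0 t htpos.le
    have h3 : t * (‖f.coeff 1‖ / ‖f.eval 0‖) = 1 := by rw [ht]; field_simp
    rw [h3] at h2
    have h4 := (hcons t htpos).trans h2
    have h5 : ‖f.eval 0‖ = t * ‖f.coeff 1‖ := by rw [ht]; field_simp
    rw [h5] at h4
    have h6 : c * ∏ i, x i ≤ ‖f.coeff 1‖ * Real.exp 1 :=
      le_of_mul_le_mul_left (by linarith) htpos
    rw [Real.exp_neg, mul_right_comm, ← div_eq_mul_inv, div_le_iff₀ (Real.exp_pos _)]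
    exact h6

/-- Gurvits' capacity inequality with the constant `e⁻ⁿ`. -/
theorem capacity_le_norm_coeff (n : ℕ) : ∀ (p : MvPolynomial (Fin n) ℂ) (c : ℝ),
    p.IsRightStable → p.IsHomogeneous n →
    (∀ x : Fin n → ℝ, (∀ i, 0 < x i) → c * ∏ i, x i ≤ ‖eval (fun i => (x i : ℂ)) p‖) →
    c * Real.exp (-n) ≤ ‖p.coeff (Finsupp.equivFunOnFinite.symm fun _ => 1)‖ := by
  induction n with
  | zero =>
    intro p c _ _ hc
    have := hc (fun _ => 1) (fun _ => one_pos)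
    rw [MvPolynomial.eq_C_of_isEmpty p] at this ⊢
    have h0 : (Finsupp.equivFunOnFinite.symm fun _ => 1 : Fin 0 →₀ ℕ) = 0 :=
      Subsingleton.elim _ _
    rw [h0]
    simpa using this
  | succ n ih =>
    intro p c hp hh hc
    have hq : ((finSuccEquiv ℂ n p).coeff 1).IsHomogeneous n :=
      hh.finSuccEquiv_coeff_isHomogeneous 1 n (by omega)
    have := ih _ (c * Real.exp (-1)) (hp.coeff_one hh) hq (capacity_coeff_one hp hh hc)
    rw [finSuccEquiv_coeff_coeff, mul_assoc, ← Real.exp_add] at this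
    convert this using 3
    · push_cast; ring_nf
    · congr 1
      ext i
      refine Fin.cases ?_ (fun j => ?_) i <;> simp

end MvPolynomial

open MvPolynomial in
lemma coeff_prod_linearForms {n : ℕ} (a : Fin n → Fin n → ℂ) :
    (∏ i, ∑ j, C (a i j) * X j : MvPolynomial (Fin n) ℂ).coeff
      (Finsupp.equivFunOnFinite.symm fun _ => 1) = ∑ σ : Equiv.Perm (Fin n), ∏ i, a i (σ i) := by
  classical
  have hmono : ∀ g : Fin n → Fin n, (∏ i, C (a i (g i)) * X (g i) : MvPolynomial (Fin n) ℂ) =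
      monomial (∑ i, Finsupp.single (g i) 1) (∏ i, a i (g i)) := by
    intro g
    simp_rw [C_mul_X_eq_monomial, monomial_sum_index, monomial_eq, Finset.prod_mul_distrib]
    simp
  have hbij : ∀ g : Fin n → Fin n, (∑ i, Finsupp.single (g i) 1 : Fin n →₀ ℕ) =
      (Finsupp.equivFunOnFinite.symm fun _ => 1) ↔ Function.Bijective g := by
    intro g
    have happ : ∀ j, (∑ i, Finsupp.single (g i) 1 : Fin n →₀ ℕ) j =
        (Finset.univ.filter fun i => g i = j).card := fun j => by
      rw [Finsupp.finsetSum_apply, Finset.card_filter]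
      exact Finset.sum_congr rfl fun i _ => by rw [Finsupp.single_apply]
    constructor
    · intro h
      rw [← Finite.surjective_iff_bijective]
      intro j
      have := DFunLike.congr_fun h j
      rw [happ] at this
      obtain ⟨i, hi⟩ := Finset.card_pos.1 (this.symm ▸ one_pos :
        0 < (Finset.univ.filter fun i => g i = j).card)
      exact ⟨i, (Finset.mem_filter.1 hi).2⟩
    · intro h
      ext j
      rw [happ]
      obtain ⟨i, rfl⟩ := h.surjective j
      simp [h.injective.eq_iff, Finset.filter_eq']
  rw [Finset.prod_univ_sum, coeff_sum]
  simp_rw [hmono, coeff_monomial, hbij]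
  rw [← Finset.sum_filter]
  symm
  refine Finset.sum_bij (fun σ _ => ⇑σ) (fun σ _ => Finset.mem_filter.2 ⟨by simp, σ.bijective⟩)
    (fun σ _ τ _ h => DFunLike.coe_injective h) (fun g hg => ?_) (fun σ _ => rfl)
  exact ⟨Equiv.ofBijective g (Finset.mem_filter.1 hg).2, Finset.mem_univ _, rfl⟩

-- Positive entries make the product of the row forms stable. Weighted AM–GM in each row, followed
-- by the column sums, shows that its capacity is at least 1.
open MvPolynomial in
lemma exp_neg_le_permanent_of_pos {n : ℕ} (a : Fin n → Fin n → ℝ) (ha : ∀ i j, 0 < a i j)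
    (hrow : ∀ i, ∑ j, a i j = 1) (hcol : ∀ j, ∑ i, a i j = 1) :
    Real.exp (-n) ≤ ∑ σ : Equiv.Perm (Fin n), ∏ i, a i (σ i) := by
  set p : MvPolynomial (Fin n) ℂ := ∏ i, ∑ j, C (a i j : ℂ) * X j with hp
  have heval : ∀ z, eval z p = ∏ i, ∑ j, (a i j : ℂ) * z j := fun z => by
    simp [hp]
  have hstab : p.IsRightStable := by
    intro z hz ⟨k, hk⟩
    rw [heval, Finset.prod_ne_zero_iff]
    intro i _ h
    have h1 := congrArg Complex.re h
    rw [Complex.re_sum, Complex.zero_re] at h1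
    simp only [Complex.re_ofReal_mul] at h1
    refine (Finset.sum_pos' (fun j _ => mul_nonneg (ha i j).le (hz j))
      ⟨k, Finset.mem_univ _, mul_pos (ha i k) hk⟩).ne' h1
  have hhom : p.IsHomogeneous n := by
    have := IsHomogeneous.prod Finset.univ
      (fun i => (∑ j, C (a i j : ℂ) * X j : MvPolynomial (Fin n) ℂ)) (fun _ => 1)
      (fun i _ => IsHomogeneous.sum _ _ _ fun j _ => isHomogeneous_C_mul_X _ _)
    simpa using this
  have hcap := capacity_le_norm_coeff n p 1 hstab hhom (fun x hx => by
    have h1 : eval (fun i => (x i : ℂ)) p = ((∏ i, ∑ j, a i j * x j : ℝ) : ℂ) := by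
      rw [heval]; push_cast; rfl
    have hnn : ∀ i, 0 ≤ ∑ j, a i j * x j := fun i =>
      Finset.sum_nonneg fun j _ => mul_nonneg (ha i j).le (hx j).le
    rw [h1, Complex.norm_real, Real.norm_of_nonneg (Finset.prod_nonneg fun i _ => hnn i), one_mul]
    calc ∏ j, x j = ∏ j, x j ^ (∑ i, a i j) := by simp [hcol]
      _ = ∏ j, ∏ i, x j ^ a i j :=
        Finset.prod_congr rfl fun j _ => Real.rpow_sum_of_pos (hx j) _ _
      _ = ∏ i, ∏ j, x j ^ a i j := Finset.prod_comm
      _ ≤ ∏ i, ∑ j, a i j * x j :=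
        Finset.prod_le_prod (fun i _ => Finset.prod_nonneg fun j _ =>
          Real.rpow_nonneg (hx j).le _) fun i _ =>
          Real.geom_mean_le_arith_mean_weighted _ _ _ (fun j _ => (ha i j).le) (hrow i)
            (fun j _ => (hx j).le))
  rw [hp, coeff_prod_linearForms, one_mul] at hcap
  have h2 : (∑ σ : Equiv.Perm (Fin n), ∏ i, (a i (σ i) : ℂ)) =
      ((∑ σ : Equiv.Perm (Fin n), ∏ i, a i (σ i) : ℝ) : ℂ) := by push_cast; rfl
  rwa [h2, Complex.norm_real, Real.norm_of_nonneg (Finset.sum_nonneg fun σ _ =>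
    Finset.prod_nonneg fun i _ => (ha i _).le)] at hcap

/-- The permanent of a doubly stochastic `n × n` matrix is at least `e⁻ⁿ`. -/
theorem exp_neg_le_permanent {n : ℕ} (a : Fin n → Fin n → ℝ) (ha : ∀ i j, 0 ≤ a i j)
    (hrow : ∀ i, ∑ j, a i j = 1) (hcol : ∀ j, ∑ i, a i j = 1) :
    Real.exp (-n) ≤ ∑ σ : Equiv.Perm (Fin n), ∏ i, a i (σ i) := by
  rcases Nat.eq_zero_or_pos n with rfl | hn
  · simp
  have hn' : (0 : ℝ) < n := by exact_mod_cast hn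
  -- Mixing with the uniform matrix makes all entries positive and keeps the row and column sums;
  -- then ε → 0.
  have hcont : Continuous fun ε : ℝ =>
      ∑ σ : Equiv.Perm (Fin n), ∏ i, ((1 - ε) * a i (σ i) + ε / n) := by fun_prop
  have htend := (hcont.tendsto 0).mono_left (nhdsWithin_le_nhds (s := Set.Ioi 0))
  simp only [sub_zero, one_mul, zero_div, add_zero] at htend
  refine ge_of_tendsto htend ?_
  filter_upwards [Ioo_mem_nhdsGT (zero_lt_one' ℝ)] with ε hε
  have hsum : ∀ f : Fin n → ℝ, ∑ j, f j = 1 → ∑ j, ((1 - ε) * f j + ε / n) = 1 := by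
    intro f hf
    rw [Finset.sum_add_distrib, ← Finset.mul_sum, hf]
    simp only [Finset.sum_const, Finset.card_univ, Fintype.card_fin, nsmul_eq_mul]
    field_simp
    ring
  exact exp_neg_le_permanent_of_pos (fun i j => (1 - ε) * a i j + ε / n)
    (fun i j => add_pos_of_nonneg_of_pos (mul_nonneg (by linarith [hε.2]) (ha i j))
      (div_pos hε.1 hn')) (fun i => hsum _ (hrow i)) (fun j => hsum _ (hcol j))

/-- A lower bound for the number of permutations with `σ i ∈ N i` when every row and every column
of the relation `N` has `r` elements. -/
theorem pow_mul_exp_neg_le_card_perm {n r : ℕ} (hr : 0 < r) (N : Fin n → Finset (Fin n))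
    (hrow : ∀ i, (N i).card = r) (hcol : ∀ j, (Finset.univ.filter fun i => j ∈ N i).card = r) :
    (r : ℝ) ^ n * Real.exp (-n) ≤
      (Finset.univ.filter fun σ : Equiv.Perm (Fin n) => ∀ i, σ i ∈ N i).card := by
  have hr' : (0 : ℝ) < r := by exact_mod_cast hr
  have h := exp_neg_le_permanent (fun i j => if j ∈ N i then (r : ℝ)⁻¹ else 0)
    (fun i j => by positivity)
    (fun i => by rw [Finset.sum_ite_mem, Finset.univ_inter, Finset.sum_const, hrow]; simp [hr'.ne'])
    (fun j => by
      rw [← Finset.sum_filter, Finset.sum_const, hcol]; simp [hr'.ne'])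
  have hprod : ∀ σ : Equiv.Perm (Fin n), (∏ i, if σ i ∈ N i then (r : ℝ)⁻¹ else 0) =
      if ∀ i, σ i ∈ N i then ((r : ℝ) ^ n)⁻¹ else 0 := by
    intro σ
    split_ifs with hσ
    · rw [Finset.prod_congr rfl fun i _ => if_pos (hσ i)]
      simp
    · push Not at hσ
      obtain ⟨i, hi⟩ := hσ
      exact Finset.prod_eq_zero (Finset.mem_univ i) (if_neg hi)
  simp_rw [hprod] at h
  rw [← Finset.sum_filter, Finset.sum_const, nsmul_eq_mul, ← div_eq_mul_inv,
    le_div_iff₀ (by positivity)] at h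
  linarith

/-! ### Brégman's bound on a large vertex subset. -/

/-- A crude Stirling bound, d! ≤ e d (d/e)^d; the induction step is log(1 + 1/d) ≥ 1/(d + 1). -/
lemma log_factorial_le {d : ℕ} (hd : 0 < d) :
    Real.log d.factorial ≤ 1 + Real.log d + d * Real.log d - d := by
  induction d, hd using Nat.le_induction with
  | base => simp
  | succ d hd ih =>
    have hd' : (0 : ℝ) < d := by exact_mod_cast hd
    rw [Nat.factorial_succ, Nat.cast_mul, Real.log_mul (by positivity) (by positivity)]
    have h1 := Real.one_sub_inv_le_log_of_pos (x := ((d : ℝ) + 1) / d) (by positivity)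
    rw [Real.log_div (by positivity) hd'.ne', inv_div] at h1
    have h2 : (1 : ℝ) ≤ (d + 1) * (Real.log (d + 1) - Real.log d) := by
      calc (1 : ℝ) = (d + 1) * (1 - d / (d + 1)) := by field_simp; ring
        _ ≤ _ := mul_le_mul_of_nonneg_left h1 (by positivity)
    push_cast
    linarith

lemma logFactorialRoot_le {d : ℕ} (hd : 0 < d) :
    logFactorialRoot d ≤ Real.log d - 1 + (1 + Real.log d) / d := by
  have hd' : (0 : ℝ) < d := by exact_mod_cast hd
  unfold logFactorialRoot
  rw [div_le_iff₀ hd', add_mul, div_mul_cancel₀ _ hd'.ne']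
  linarith [log_factorial_le hd]

section PermsOn

variable {V : Type} [Fintype V] [DecidableEq V]

/-- The permutations of `U`, extended by the identity, which send every `i ∈ U` into `N i`. -/
def permsOn (N : V → Finset V) (U : Finset V) : Finset (Equiv.Perm V) :=
  Finset.univ.filter fun σ => (∀ i ∈ U, σ i ∈ N i) ∧ ∀ i, i ∉ U → σ i = i

lemma mem_permsOn {N : V → Finset V} {U : Finset V} {σ : Equiv.Perm V} :
    σ ∈ permsOn N U ↔ (∀ i ∈ U, σ i ∈ N i) ∧ ∀ i, i ∉ U → σ i = i := by
  simp [permsOn]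

lemma apply_mem_iff_of_mem_permsOn {N : V → Finset V} {U : Finset V} {σ : Equiv.Perm V}
    (hσ : σ ∈ permsOn N U) (i : V) : σ i ∈ U ↔ i ∈ U := by
  have h := (mem_permsOn.1 hσ).2
  constructor
  · intro hi
    by_contra h'
    rw [h i h'] at hi
    exact h' hi
  · intro hi
    by_contra h'
    have := σ.injective (h _ h')
    rw [this] at h'
    exact h' hi

lemma card_permsOn_le_card_equivsIn (N : V → Finset V) (U : Finset V) :
    (permsOn N U).card ≤ (equivsIn fun i : {i // i ∈ U} => (N i).subtype (· ∈ U)).card := by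
  classical
  refine Finset.card_le_card_of_injOn
    (fun σ => if h : σ ∈ permsOn N U then σ.subtypePerm (p := (· ∈ U))
      (apply_mem_iff_of_mem_permsOn h) else 1) ?_ ?_
  · intro σ hσ
    have hσ' : σ ∈ permsOn N U := hσ
    have h := mem_permsOn.1 hσ'
    simp only [dif_pos hσ', equivsIn, Finset.coe_filter, Set.mem_ofPred_eq, Finset.mem_univ,
      true_and, Finset.mem_subtype]
    exact fun i => h.1 i i.2
  · intro σ hσ τ hτ heq
    have hσ' : σ ∈ permsOn N U := hσ
    have hτ' : τ ∈ permsOn N U := hτ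
    simp only [dif_pos hσ', dif_pos hτ'] at heq
    ext a
    by_cases ha : a ∈ U
    · exact congrArg (fun f : Equiv.Perm {i // i ∈ U} => (f ⟨a, ha⟩ : V)) heq
    · rw [(mem_permsOn.1 hσ').2 a ha, (mem_permsOn.1 hτ').2 a ha]

lemma log_card_permsOn_le (N : V → Finset V) (U : Finset V) (h : (permsOn N U).Nonempty) :
    Real.log (permsOn N U).card ≤ ∑ i ∈ U, logFactorialRoot (N i ∩ U).card := by
  have hle := card_permsOn_le_card_equivsIn N U
  have hpos := h.card_pos
  refine (Real.log_le_log (Nat.cast_pos.2 hpos) (Nat.cast_le.2 hle)).trans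
    ((log_card_equivsIn_le _ _ rfl (Finset.card_pos.1 (hpos.trans_le hle))).trans (le_of_eq ?_))
  rw [Finset.sum_subtype U (p := (· ∈ U)) (by simp)]
  refine Finset.sum_congr rfl fun i _ => ?_
  rw [Finset.card_subtype, Finset.filter_mem_eq_inter]

/-- Brégman's bound for the permutations of a large vertex subset in a regular relation. -/
theorem card_permsOn_le {r : ℕ} (N : V → Finset V) (hrow : ∀ i, (N i).card = r)
    (hcol : ∀ j, (Finset.univ.filter fun i => j ∈ N i).card = r) (U : Finset V) (L : ℝ)
    (hL : (Uᶜ.card : ℝ) ≤ L) (hLr : L < r) :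
    ((permsOn N U).card : ℝ) ≤ Real.exp (L ^ 2 / r +
      Fintype.card V * (1 + Real.log (Fintype.card V)) / (r - L) - Fintype.card V) *
      (r : ℝ) ^ U.card := by
  set n := Fintype.card V with hn
  rcases (permsOn N U).eq_empty_or_nonempty with he | hne
  · rw [he, Finset.card_empty, Nat.cast_zero]; positivity
  have hL0 : 0 ≤ L := (Nat.cast_nonneg _).trans hL
  have hr : (0 : ℝ) < r := hL0.trans_lt hLr
  have hq : 0 < r - L := by linarith
  have hcardU : (U.card : ℝ) + Uᶜ.card = n := by
    exact_mod_cast Finset.card_add_card_compl U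
  have hsub : ∀ A : Finset V, (A.card : ℝ) ≤ (A ∩ U).card + L := by
    intro A
    have h1 : A.card ≤ (A ∩ U).card + Uᶜ.card := by
      rw [← Finset.card_inter_add_card_sdiff A U]
      gcongr
      intro x hx
      simp at hx ⊢
      exact hx.2
    have : (A.card : ℝ) ≤ (A ∩ U).card + Uᶜ.card := by exact_mod_cast h1
    linarith
  have hdeg : ∀ i, (r : ℝ) - L ≤ (N i ∩ U).card := fun i => by
    have := hsub (N i); rw [hrow] at this; linarith
  have hdeg' : ∀ i, ((N i ∩ U).card : ℝ) ≤ n := fun i => by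
    exact_mod_cast Finset.card_le_univ _
  have hterm : ∀ i ∈ U, logFactorialRoot (N i ∩ U).card ≤
      Real.log r + ((N i ∩ U).card - r) / r - 1 + (1 + Real.log n) / (r - L) := by
    intro i _
    have hd : (0 : ℝ) < (N i ∩ U).card := hq.trans_le (hdeg i)
    have hd1 : (1 : ℝ) ≤ (N i ∩ U).card := by exact_mod_cast Nat.cast_pos.1 hd
    refine (logFactorialRoot_le (Nat.cast_pos.1 hd)).trans ?_
    have h1 : Real.log (N i ∩ U).card ≤ Real.log r + ((N i ∩ U).card - r) / r := by
      have := Real.log_le_sub_one_of_pos (div_pos hd hr)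
      rw [Real.log_div hd.ne' hr.ne'] at this
      rw [sub_div, div_self hr.ne']
      linarith
    have h2 : (1 + Real.log (N i ∩ U).card) / (N i ∩ U).card ≤ (1 + Real.log n) / (r - L) := by
      have h3 : Real.log (N i ∩ U).card ≤ Real.log n := Real.log_le_log hd (hdeg' i)
      have h4 : 0 ≤ Real.log (N i ∩ U).card := Real.log_nonneg hd1
      exact div_le_div₀ (by linarith) (by linarith) hq (hdeg i)
    linarith
  -- The degrees lost inside U are counted by columns: each vertex outside U is missed by at least r
  -- - L of the rows in U.
  have hcount : ∑ i ∈ U, (((N i ∩ U).card : ℝ) - r) ≤ -(Uᶜ.card * (r - L)) := by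
    have h1 : ∀ i ∈ U, ((N i ∩ U).card : ℝ) - r = -∑ k ∈ Uᶜ, if k ∈ N i then (1 : ℝ) else 0 := by
      intro i _
      rw [← hrow i, ← Finset.card_inter_add_card_sdiff (N i) U, ← Finset.sum_filter,
        Finset.sum_const, nsmul_eq_mul, mul_one]
      have : Uᶜ.filter (· ∈ N i) = N i \ U := by ext; simp [and_comm]
      rw [this]
      push_cast
      ring
    rw [Finset.sum_congr rfl h1, Finset.sum_neg_distrib, Finset.sum_comm, neg_le_neg_iff,
      ← nsmul_eq_mul]
    refine Finset.card_nsmul_le_sum _ _ _ fun k _ => ?_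
    have h2 := hsub (Finset.univ.filter fun i => k ∈ N i)
    rw [hcol] at h2
    rw [← Finset.sum_filter, Finset.sum_const, nsmul_eq_mul, mul_one]
    have : (Finset.univ.filter fun i => k ∈ N i) ∩ U = U.filter fun i => k ∈ N i := by
      ext; simp [and_comm]
    rw [this] at h2
    linarith
  have hUc : (0 : ℝ) ≤ Uᶜ.card := Nat.cast_nonneg _
  have hlogn : 0 ≤ Real.log n := Real.log_natCast_nonneg n
  have hlog : Real.log (permsOn N U).card ≤
      L ^ 2 / r + n * (1 + Real.log n) / (r - L) - n + U.card * Real.log r := by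
    refine (log_card_permsOn_le N U hne).trans ((Finset.sum_le_sum hterm).trans ?_)
    simp only [Finset.sum_add_distrib, Finset.sum_sub_distrib, ← Finset.sum_div,
      Finset.sum_const, nsmul_eq_mul] at hcount ⊢
    have h1 := div_le_div_of_nonneg_right hcount hr.le
    -- The term -|Uᶜ| combines with the -|U| from the factorials to give the full -n, so removing
    -- vertices costs only L²/r.
    have h2 : -(Uᶜ.card * ((r : ℝ) - L)) / r ≤ -Uᶜ.card + L ^ 2 / r := by
      rw [div_le_iff₀ hr, add_mul, div_mul_cancel₀ _ hr.ne']
      nlinarith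
    have h3 : (U.card * 1 + U.card * Real.log n) / (r - L) ≤ n * (1 + Real.log n) / (r - L) := by
      refine div_le_div_of_nonneg_right ?_ hq.le
      rw [← mul_add]
      exact mul_le_mul_of_nonneg_right (by linarith) (by positivity)
    linarith
  rw [← Real.exp_log (show (0 : ℝ) < (permsOn N U).card from Nat.cast_pos.2 hne.card_pos),
    ← Real.exp_log (pow_pos hr U.card), ← Real.exp_add, Real.log_pow]
  exact Real.exp_le_exp.2 hlog

end PermsOn

/-! ### Orbits of a permutation and the number of cycles. -/

section Orbits

variable {V : Type} [Fintype V]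

lemma minimalPeriod_perm_pos (σ : Equiv.Perm V) (v : V) : 0 < Function.minimalPeriod σ v :=
  Function.minimalPeriod_pos_of_mem_periodicPts
    (σ.injective.mem_periodicPts v)

variable [DecidableEq V]

open Classical in
/-- The orbit of `v` under `σ`. -/
noncomputable def orbitFinset (σ : Equiv.Perm V) (v : V) : Finset V :=
  Finset.univ.filter (σ.SameCycle v)

lemma mem_orbitFinset {σ : Equiv.Perm V} {v w : V} : w ∈ orbitFinset σ v ↔ σ.SameCycle v w := by
  simp [orbitFinset]

lemma self_mem_orbitFinset (σ : Equiv.Perm V) (v : V) : v ∈ orbitFinset σ v :=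
  mem_orbitFinset.2 (.refl _ _)

lemma orbitFinset_eq_iff {σ : Equiv.Perm V} {v w : V} :
    orbitFinset σ v = orbitFinset σ w ↔ σ.SameCycle v w := by
  constructor
  · intro h
    exact mem_orbitFinset.1 (h ▸ self_mem_orbitFinset σ w)
  · intro h
    ext x
    rw [mem_orbitFinset, mem_orbitFinset]
    exact ⟨fun h' => h.symm.trans h', fun h' => h.trans h'⟩

lemma sameCycle_iff_exists_iterate {σ : Equiv.Perm V} {v w : V} :
    σ.SameCycle v w ↔ ∃ t < Function.minimalPeriod σ v, σ^[t] v = w := by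
  constructor
  · intro h
    obtain ⟨t, -, -, ht⟩ := h.exists_pow_eq
    refine ⟨t % Function.minimalPeriod σ v, Nat.mod_lt _ (minimalPeriod_perm_pos σ v), ?_⟩
    rw [Function.iterate_mod_minimalPeriod_eq, Equiv.Perm.iterate_eq_pow, ht]
  · rintro ⟨t, -, rfl⟩
    rw [Equiv.Perm.iterate_eq_pow]
    exact ⟨t, by simp⟩

lemma orbitFinset_eq_image (σ : Equiv.Perm V) (v : V) :
    orbitFinset σ v = (Finset.range (Function.minimalPeriod σ v)).image (fun t => σ^[t] v) := by
  ext w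
  rw [mem_orbitFinset, sameCycle_iff_exists_iterate]
  simp

lemma card_orbitFinset (σ : Equiv.Perm V) (v : V) :
    (orbitFinset σ v).card = Function.minimalPeriod σ v := by
  rw [orbitFinset_eq_image, Finset.card_image_of_injOn, Finset.card_range]
  intro s hs t ht h
  exact Function.iterate_injOn_Iio_minimalPeriod (by simpa using hs) (by simpa using ht) h

/-- The number of orbits of a permutation is its number of cycles, fixed points included. -/
lemma card_image_orbitFinset (σ : Equiv.Perm V) :
    (Finset.univ.image (orbitFinset σ)).card =
      Multiset.card σ.cycleType + (Finset.univ.filter fun i => σ i = i).card := by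
  classical
  have hcyc : Multiset.card σ.cycleType = (σ.cycleFactorsFinset.image Equiv.Perm.support).card := by
    rw [Equiv.Perm.cycleType_def, Multiset.card_map, Finset.card_val,
      Finset.card_image_of_injOn]
    intro c hc d hd h
    exact (σ.cycleFactorsFinset_pairwise_disjoint).eq hc hd (fun hdis => by
      have h1 := hdis.disjoint_support
      rw [h, disjoint_self] at h1
      exact (Equiv.Perm.mem_cycleFactorsFinset_iff.1 hd).1.ne_one
        (Equiv.Perm.support_eq_empty_iff.1 h1))
  have hfix : (Finset.univ.filter fun i => σ i = i).card =
      ((Finset.univ.filter fun i => σ i = i).image fun i => ({i} : Finset V)).card :=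
    (Finset.card_image_of_injective _ Finset.singleton_injective).symm
  have hsupp : ∀ v, σ v ≠ v → orbitFinset σ v = (σ.cycleOf v).support := by
    intro v hv
    ext w
    rw [mem_orbitFinset, Equiv.Perm.mem_support_cycleOf_iff]
    simp [hv]
  have hsing : ∀ v, σ v = v → orbitFinset σ v = {v} := by
    intro v hv
    ext w
    rw [mem_orbitFinset, Finset.mem_singleton]
    constructor
    · rintro ⟨k, rfl⟩
      exact Equiv.Perm.zpow_apply_eq_self_of_apply_eq_self hv k
    · rintro rfl; exact .refl _ _
  rw [hcyc, hfix, ← Finset.card_union_of_disjoint]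
  · congr 1
    ext s
    simp only [Finset.mem_image, Finset.mem_univ, true_and, Finset.mem_union, Finset.mem_filter]
    constructor
    · rintro ⟨v, rfl⟩
      by_cases hv : σ v = v
      · exact Or.inr ⟨v, hv, (hsing v hv).symm⟩
      · exact Or.inl ⟨σ.cycleOf v, Equiv.Perm.cycleOf_mem_cycleFactorsFinset_iff.2
          (Equiv.Perm.mem_support.2 hv), (hsupp v hv).symm⟩
    · rintro (⟨c, hc, rfl⟩ | ⟨v, hv, rfl⟩)
      · obtain ⟨v, hv⟩ := (Equiv.Perm.mem_cycleFactorsFinset_iff.1 hc).1.nonempty_support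
        have hcv := Equiv.Perm.cycle_is_cycleOf hv hc
        refine ⟨v, ?_⟩
        rw [hcv]
        refine hsupp v (Equiv.Perm.mem_support.1 ?_)
        exact Equiv.Perm.mem_cycleFactorsFinset_support_le hc hv
      · exact ⟨v, hsing v hv⟩
  · rw [Finset.disjoint_left]
    intro s hs hs'
    obtain ⟨c, hc, rfl⟩ := Finset.mem_image.1 hs
    obtain ⟨v, -, hv⟩ := Finset.mem_image.1 hs'
    have := (Equiv.Perm.mem_cycleFactorsFinset_iff.1 hc).1.two_le_card_support
    rw [← hv] at this
    simp at this

end Orbits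

/-! ### Peeling off short cycles. -/

section ShortCycles

variable {V : Type} [DecidableEq V]

/-- The walks with `l` steps that start at `v` and follow `N`. -/
def walks (N : V → Finset V) : ℕ → V → Finset (List V)
  | 0, v => {[v]}
  | l + 1, v => (N v).biUnion fun w => (walks N l w).image (v :: ·)

lemma card_walks_le (N : V → Finset V) {r : ℕ} (hN : ∀ i, (N i).card = r) (l : ℕ) :
    ∀ v, (walks N l v).card ≤ r ^ l := by
  induction l with
  | zero => intro v; simp [walks]
  | succ l ih =>
    intro v
    calc (walks N (l + 1) v).card ≤ ∑ w ∈ N v, ((walks N l w).image (v :: ·)).card :=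
          Finset.card_biUnion_le
      _ ≤ ∑ _w ∈ N v, r ^ l :=
          Finset.sum_le_sum fun w _ => Finset.card_image_le.trans (ih w)
      _ = r ^ (l + 1) := by rw [Finset.sum_const, hN, smul_eq_mul, pow_succ, mul_comm]

variable [Fintype V]

/-- The orbits of `σ` meeting `U` with at most `m` elements. -/
noncomputable def shortOrbits (σ : Equiv.Perm V) (U : Finset V) (m : ℕ) : Finset (Finset V) :=
  (U.image (orbitFinset σ)).filter fun s => s.card ≤ m

/-- The permutations in `permsOn N U` with at least `κ` short orbits. -/
noncomputable def permsManyShort (N : V → Finset V) (U : Finset V) (m : ℕ) (κ : ℝ) :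
    Finset (Equiv.Perm V) :=
  open Classical in (permsOn N U).filter fun σ => κ ≤ (shortOrbits σ U m).card

lemma iterate_mem_walks {N : V → Finset V} {U : Finset V} {σ : Equiv.Perm V}
    (hσ : σ ∈ permsOn N U) (l : ℕ) : ∀ v ∈ U, List.iterate σ v (l + 1) ∈ walks N l v := by
  induction l with
  | zero => intro v _; simp [walks, List.iterate]
  | succ l ih =>
    intro v hv
    rw [List.iterate]
    exact Finset.mem_biUnion.2 ⟨σ v, (mem_permsOn.1 hσ).1 v hv, Finset.mem_image_of_mem _
      (ih _ ((apply_mem_iff_of_mem_permsOn hσ v).2 hv))⟩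

lemma toFinset_iterate_minimalPeriod (σ : Equiv.Perm V) (v : V) :
    (List.iterate σ v (Function.minimalPeriod σ v)).toFinset = orbitFinset σ v := by
  ext w
  rw [mem_orbitFinset, sameCycle_iff_exists_iterate, List.mem_toFinset, List.mem_iterate]
  simp [eq_comm]

lemma orbitFinset_subset {N : V → Finset V} {U : Finset V} {σ : Equiv.Perm V}
    (hσ : σ ∈ permsOn N U) {v : V} (hv : v ∈ U) : orbitFinset σ v ⊆ U := by
  intro w hw
  rw [mem_orbitFinset, sameCycle_iff_exists_iterate] at hw
  obtain ⟨t, -, rfl⟩ := hw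
  induction t with
  | zero => exact hv
  | succ t ih =>
    rw [Function.iterate_succ_apply']
    exact (apply_mem_iff_of_mem_permsOn hσ _).2 ih

open Classical in
/-- The permutation that agrees with `σ` off the orbit of `v` and fixes the orbit pointwise. -/
noncomputable def removeOrbit (σ : Equiv.Perm V) (v : V) : Equiv.Perm V :=
  σ * (σ.cycleOf v)⁻¹

lemma removeOrbit_apply_of_mem {σ : Equiv.Perm V} {v w : V} (h : w ∈ orbitFinset σ v) :
    removeOrbit σ v w = w := by
  classical
  have h' := mem_orbitFinset.1 h
  unfold removeOrbit
  rw [Equiv.Perm.mul_apply, Equiv.Perm.cycleOf_inv, Equiv.Perm.cycleOf_apply,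
    if_pos (Equiv.Perm.sameCycle_inv.2 h')]
  simp

lemma removeOrbit_apply_of_notMem {σ : Equiv.Perm V} {v w : V} (h : w ∉ orbitFinset σ v) :
    removeOrbit σ v w = σ w := by
  classical
  rw [mem_orbitFinset] at h
  unfold removeOrbit
  rw [Equiv.Perm.mul_apply, Equiv.Perm.cycleOf_inv, Equiv.Perm.cycleOf_apply,
    if_neg (fun h' => h (Equiv.Perm.sameCycle_inv.1 h'))]

/-- The iterates starting at w never enter the removed orbit, so both permutations have the same
iterates there. -/
lemma orbitFinset_removeOrbit {σ : Equiv.Perm V} {v w : V} (h : w ∉ orbitFinset σ v) :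
    orbitFinset (removeOrbit σ v) w = orbitFinset σ w := by
  have hit : ∀ t, (removeOrbit σ v)^[t] w = σ^[t] w := by
    intro t
    induction t with
    | zero => rfl
    | succ t ih =>
      rw [Function.iterate_succ_apply', Function.iterate_succ_apply', ih,
        removeOrbit_apply_of_notMem]
      intro hm
      refine h (mem_orbitFinset.2 ((mem_orbitFinset.1 hm).trans (.symm ?_)))
      rw [Equiv.Perm.iterate_eq_pow]
      exact ⟨t, by simp⟩
  have hp : Function.minimalPeriod (removeOrbit σ v) w = Function.minimalPeriod σ w := by
    refine Nat.dvd_antisymm ?_ ?_ <;>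
      rw [← Function.isPeriodicPt_iff_minimalPeriod_dvd, Function.IsPeriodicPt,
        Function.IsFixedPt]
    · rw [hit, Function.iterate_minimalPeriod]
    · rw [← hit, Function.iterate_minimalPeriod]
  rw [orbitFinset_eq_image, orbitFinset_eq_image, hp]
  exact Finset.image_congr fun t _ => hit t

/-- Every other orbit survives unchanged, so at most one short orbit is lost. -/
lemma removeOrbit_mem_permsManyShort {N : V → Finset V} {U : Finset V} {m : ℕ} {κ : ℝ}
    {σ : Equiv.Perm V} (hσ : σ ∈ permsManyShort N U m κ) (v : V) :
    removeOrbit σ v ∈ permsManyShort N (U \ orbitFinset σ v) m (κ - 1) := by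
  classical
  obtain ⟨hσ1, hσ2⟩ := Finset.mem_filter.1 hσ
  refine Finset.mem_filter.2 ⟨mem_permsOn.2 ⟨fun i hi => ?_, fun i hi => ?_⟩, ?_⟩
  · obtain ⟨h1, h2⟩ := Finset.mem_sdiff.1 hi
    rw [removeOrbit_apply_of_notMem h2]
    exact (mem_permsOn.1 hσ1).1 i h1
  · by_cases h : i ∈ orbitFinset σ v
    · exact removeOrbit_apply_of_mem h
    · rw [removeOrbit_apply_of_notMem h]
      exact (mem_permsOn.1 hσ1).2 i fun h' => hi (Finset.mem_sdiff.2 ⟨h', h⟩)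
  · have hsub : shortOrbits σ U m ⊆ insert (orbitFinset σ v)
        (shortOrbits (removeOrbit σ v) (U \ orbitFinset σ v) m) := by
      intro s hs
      obtain ⟨hs1, hs2⟩ := Finset.mem_filter.1 hs
      obtain ⟨w, hw, rfl⟩ := Finset.mem_image.1 hs1
      by_cases h : w ∈ orbitFinset σ v
      · exact Finset.mem_insert.2 (Or.inl (orbitFinset_eq_iff.2 (mem_orbitFinset.1 h).symm))
      · refine Finset.mem_insert_of_mem (Finset.mem_filter.2 ⟨Finset.mem_image.2 ⟨w,
          Finset.mem_sdiff.2 ⟨hw, h⟩, orbitFinset_removeOrbit h⟩, hs2⟩)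
    have h1 := (Finset.card_le_card hsub).trans (Finset.card_insert_le _ _)
    have h2 : ((shortOrbits σ U m).card : ℝ) ≤
        (shortOrbits (removeOrbit σ v) (U \ orbitFinset σ v) m).card + 1 := by exact_mod_cast h1
    linarith

/-- Two permutations with the same orbit of `v`, traversed in the same way, that agree off this
orbit, are equal. -/
lemma eq_of_iterate_eq_of_removeOrbit_eq {σ τ : Equiv.Perm V} {v : V}
    (hper : Function.minimalPeriod σ v = Function.minimalPeriod τ v)
    (hit : List.iterate σ v (Function.minimalPeriod σ v) =
      List.iterate τ v (Function.minimalPeriod τ v))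
    (hrem : removeOrbit σ v = removeOrbit τ v) : σ = τ := by
  have horb : orbitFinset σ v = orbitFinset τ v := by
    rw [← toFinset_iterate_minimalPeriod, hit, toFinset_iterate_minimalPeriod]
  have hlt : ∀ t < Function.minimalPeriod σ v, σ^[t] v = τ^[t] v := by
    intro t ht
    have h1 := congrArg (fun l => l[t]?) hit
    simpa [List.getElem?_eq_getElem, ht, ← hper] using h1
  have hle : ∀ t ≤ Function.minimalPeriod σ v, σ^[t] v = τ^[t] v := by
    intro t ht
    rcases ht.lt_or_eq with h | rfl
    · exact hlt t h
    · rw [Function.iterate_minimalPeriod, hper, Function.iterate_minimalPeriod]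
  ext w
  by_cases hw : w ∈ orbitFinset σ v
  · rw [mem_orbitFinset, sameCycle_iff_exists_iterate] at hw
    obtain ⟨t, ht, rfl⟩ := hw
    rw [← Function.iterate_succ_apply' (f := σ), hle _ ht, hlt t ht,
      ← Function.iterate_succ_apply' (f := τ)]
  · rw [← removeOrbit_apply_of_notMem hw, hrem, removeOrbit_apply_of_notMem (horb ▸ hw)]

/-- Peeling one short cycle: the basic recursion for the number of permutations with many short
cycles. -/
lemma mul_card_permsManyShort_le {N : V → Finset V} {r : ℕ} (hN : ∀ i, (N i).card = r)
    (U : Finset V) (m : ℕ) (κ B : ℝ) (hB : 0 ≤ B)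
    (hrec : ∀ U' ⊆ U, U.card ≤ U'.card + m →
      ((permsManyShort N U' m (κ - 1)).card : ℝ) ≤ B * (r : ℝ) ^ U'.card) :
    κ * (permsManyShort N U m κ).card * r ≤ U.card * m * (B * (r : ℝ) ^ U.card) := by
  classical
  set P := permsManyShort N U m κ with hP
  have hsub : ∀ σ ∈ P, σ ∈ permsOn N U := fun σ hσ => (Finset.mem_filter.1 hσ).1
  -- Each short orbit contains at least one such vertex; counting just one per orbit is enough.
  have hfew : ∀ σ ∈ P, κ ≤ (U.filter fun v => Function.minimalPeriod σ v ≤ m).card := by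
    intro σ hσ
    refine (Finset.mem_filter.1 hσ).2.trans (Nat.cast_le.2 ?_)
    refine (Finset.card_le_card ?_).trans (Finset.card_image_le (f := orbitFinset σ))
    intro s hs
    obtain ⟨hs1, hs2⟩ := Finset.mem_filter.1 hs
    obtain ⟨w, hw, rfl⟩ := Finset.mem_image.1 hs1
    exact Finset.mem_image_of_mem _ (Finset.mem_filter.2 ⟨hw, (card_orbitFinset σ w) ▸ hs2⟩)
  -- Once the traversal w of the cycle is fixed, σ is determined by what remains after the cycle is
  -- removed.
  have hfibre : ∀ v ∈ U, ∀ l < m, ∀ w ∈ walks N l v,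
      ((P.filter fun σ : Equiv.Perm V => Function.minimalPeriod σ v = l + 1 ∧
        List.iterate σ v (l + 1) = w).card : ℝ) * (r : ℝ) ^ (l + 1) ≤ B * (r : ℝ) ^ U.card := by
    intro v hv l hl w _
    set F := P.filter fun σ : Equiv.Perm V => Function.minimalPeriod σ v = l + 1 ∧
        List.iterate σ v (l + 1) = w with hF
    have horb : ∀ σ ∈ F, orbitFinset σ v = w.toFinset := by
      intro σ hσ
      obtain ⟨-, h1, h2⟩ := Finset.mem_filter.1 hσ
      rw [← toFinset_iterate_minimalPeriod, h1, h2]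
    rcases F.eq_empty_or_nonempty with he | ⟨σ₀, hσ₀⟩
    · rw [he]; simp; positivity
    have hw1 : w.toFinset ⊆ U := by
      rw [← horb σ₀ hσ₀]
      exact orbitFinset_subset (hsub _ (Finset.mem_filter.1 hσ₀).1) hv
    have hw2 : w.toFinset.card = l + 1 := by
      rw [← horb σ₀ hσ₀, card_orbitFinset, (Finset.mem_filter.1 hσ₀).2.1]
    have hcard := Finset.card_sdiff_add_card_eq_card hw1
    have hinj : F.card ≤ (permsManyShort N (U \ w.toFinset) m (κ - 1)).card := by
      refine Finset.card_le_card_of_injOn (fun σ => removeOrbit σ v) ?_ ?_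
      · intro σ hσ
        have := removeOrbit_mem_permsManyShort (Finset.mem_filter.1 hσ).1 v
        rw [horb σ hσ] at this
        exact this
      · intro σ hσ τ hτ h
        obtain ⟨-, h1, h2⟩ := Finset.mem_filter.1 hσ
        obtain ⟨-, h3, h4⟩ := Finset.mem_filter.1 hτ
        exact eq_of_iterate_eq_of_removeOrbit_eq (h1.trans h3.symm)
          (by rw [h1, h3, h2, h4]) h
    have h5 := hrec (U \ w.toFinset) Finset.sdiff_subset (by omega)
    calc (F.card : ℝ) * (r : ℝ) ^ (l + 1)
        ≤ (B * (r : ℝ) ^ (U \ w.toFinset).card) * (r : ℝ) ^ (l + 1) :=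
          mul_le_mul_of_nonneg_right ((Nat.cast_le.2 hinj).trans h5) (by positivity)
      _ = B * (r : ℝ) ^ U.card := by rw [mul_assoc, ← pow_add, ← hw2, hcard]
  -- At most r^l walks against a saving of r^(l+1): the closing step is forced, hence the extra
  -- factor r on the left.
  have hlen : ∀ v ∈ U, ∀ l < m,
      ((P.filter fun σ : Equiv.Perm V => Function.minimalPeriod σ v = l + 1).card : ℝ) * r ≤
        B * (r : ℝ) ^ U.card := by
    intro v hv l hl
    have hmaps : ∀ σ ∈ P.filter fun σ : Equiv.Perm V => Function.minimalPeriod σ v = l + 1,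
        List.iterate σ v (l + 1) ∈ walks N l v := fun σ hσ =>
      iterate_mem_walks (hsub _ (Finset.mem_filter.1 hσ).1) l v hv
    rcases Nat.eq_zero_or_pos r with hr | hr
    · rw [hr]; simp; positivity
    have hr' : (0 : ℝ) < (r : ℝ) ^ l := by positivity
    rw [Finset.card_eq_sum_card_fiberwise hmaps]
    refine le_of_mul_le_mul_right ?_ hr'
    push_cast
    rw [mul_assoc, ← pow_succ', Finset.sum_mul]
    calc _ ≤ ∑ _w ∈ walks N l v, B * (r : ℝ) ^ U.card := by
          refine Finset.sum_le_sum fun w hw => ?_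
          rw [Finset.filter_filter]
          exact hfibre v hv l hl w hw
      _ = (walks N l v).card * (B * (r : ℝ) ^ U.card) := by rw [Finset.sum_const, nsmul_eq_mul]
      _ ≤ (r : ℝ) ^ l * (B * (r : ℝ) ^ U.card) :=
          mul_le_mul_of_nonneg_right (by exact_mod_cast card_walks_le N hN l v) (by positivity)
      _ = _ := by ring
  have hvert : ∀ v ∈ U,
      ((P.filter fun σ : Equiv.Perm V => Function.minimalPeriod σ v ≤ m).card : ℝ) * r ≤
      m * (B * (r : ℝ) ^ U.card) := by
    intro v hv
    have hmaps : ∀ σ ∈ P.filter fun σ : Equiv.Perm V => Function.minimalPeriod σ v ≤ m,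
        Function.minimalPeriod σ v - 1 ∈ Finset.range m := fun σ hσ => by
      have := (Finset.mem_filter.1 hσ).2
      have := minimalPeriod_perm_pos σ v
      rw [Finset.mem_range]; omega
    rw [Finset.card_eq_sum_card_fiberwise hmaps]
    push_cast
    rw [Finset.sum_mul]
    calc _ ≤ ∑ _l ∈ Finset.range m, B * (r : ℝ) ^ U.card := by
          refine Finset.sum_le_sum fun l hl => ?_
          refine le_trans (mul_le_mul_of_nonneg_right (Nat.cast_le.2 (Finset.card_le_card ?_))
            (Nat.cast_nonneg _)) (hlen v hv l (Finset.mem_range.1 hl))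
          intro σ hσ
          rw [Finset.filter_filter, Finset.mem_filter] at hσ
          refine Finset.mem_filter.2 ⟨hσ.1, ?_⟩
          have := minimalPeriod_perm_pos σ v
          omega
      _ = _ := by rw [Finset.sum_const, Finset.card_range, nsmul_eq_mul]
  calc κ * P.card * r = (∑ _σ ∈ P, κ) * r := by rw [Finset.sum_const, nsmul_eq_mul]; ring
    _ ≤ (∑ σ ∈ P, ((U.filter fun v => Function.minimalPeriod σ v ≤ m).card : ℝ)) * r :=
        mul_le_mul_of_nonneg_right (Finset.sum_le_sum hfew) (Nat.cast_nonneg _)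
    _ = (∑ v ∈ U,
          ((P.filter fun σ : Equiv.Perm V => Function.minimalPeriod σ v ≤ m).card : ℝ)) * r := by
        congr 1
        simp_rw [Finset.card_filter]
        push_cast
        exact Finset.sum_comm
    _ = ∑ v ∈ U, ((P.filter fun σ : Equiv.Perm V => Function.minimalPeriod σ v ≤ m).card : ℝ) * r :=
        Finset.sum_mul _ _ _
    _ ≤ ∑ _v ∈ U, m * (B * (r : ℝ) ^ U.card) := Finset.sum_le_sum hvert
    _ = _ := by rw [Finset.sum_const, nsmul_eq_mul]; ring

/-- Iterating the peeling `j` times. -/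
lemma card_permsManyShort_le {N : V → Finset V} {r : ℕ} (hr : 0 < r) (hN : ∀ i, (N i).card = r)
    (m : ℕ) (k₀ Q : ℝ) (hk : 0 < k₀) (hQ : 0 ≤ Q) (J : ℕ)
    (hbase : ∀ U : Finset V, Uᶜ.card ≤ J * m →
      ((permsOn N U).card : ℝ) ≤ Q * (r : ℝ) ^ U.card) (j : ℕ) :
    ∀ i, i + j ≤ J → ∀ (U : Finset V) (κ : ℝ), Uᶜ.card ≤ i * m → k₀ + j ≤ κ →
      ((permsManyShort N U m κ).card : ℝ) ≤
        (Fintype.card V * m / (r * k₀)) ^ j * Q * (r : ℝ) ^ U.card := by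
  classical
  have hr' : (0 : ℝ) < r := by exact_mod_cast hr
  -- Here i bounds the peels already made and j is the number still to come. The condition k₀ + j ≤
  -- κ keeps at least k₀ short orbits available at every peel.
  induction j with
  | zero =>
    intro i hi U κ hU _
    rw [pow_zero, one_mul]
    refine le_trans (Nat.cast_le.2 (Finset.card_filter_le _ _)) (hbase U (hU.trans ?_))
    gcongr
    omega
  | succ j ih =>
    intro i hi U κ hU hκ
    push_cast at hκ
    set a : ℝ := Fintype.card V * m / (r * k₀) with ha
    have ha0 : 0 ≤ a := by positivity
    have h := mul_card_permsManyShort_le hN U m κ (a ^ j * Q) (by positivity)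
      (fun U' hU' hcard => ih (i + 1) (by omega) U' (κ - 1) (by
        have h1 := Finset.card_add_card_compl U
        have h2 := Finset.card_add_card_compl U'
        rw [add_mul, one_mul]
        omega) (by linarith))
    have hj : (0 : ℝ) ≤ j := Nat.cast_nonneg _
    have h1 : k₀ * (permsManyShort N U m κ).card * r ≤
        Fintype.card V * m * (a ^ j * Q * (r : ℝ) ^ U.card) := by
      calc _ ≤ κ * (permsManyShort N U m κ).card * r := by gcongr; linarith
        _ ≤ _ := h
        _ ≤ _ := by gcongr; exact Finset.card_le_univ _
    have h2 : (Fintype.card V : ℝ) * m = a * (r * k₀) := by rw [ha]; field_simp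
    rw [h2] at h1
    refine le_of_mul_le_mul_left (a := r * k₀) ?_ (by positivity)
    calc _ = k₀ * (permsManyShort N U m κ).card * r := by ring
      _ ≤ _ := h1
      _ = _ := by ring

/-- A permutation has at most `n / (m + 1)` cycles of length more than `m`. -/
lemma numOrbits_le_card_shortOrbits_add (σ : Equiv.Perm V) (m : ℕ) :
    ((Finset.univ.image (orbitFinset σ)).card : ℝ) ≤
      (shortOrbits σ Finset.univ m).card + Fintype.card V / (m + 1) := by
  classical
  set O := Finset.univ.image (orbitFinset σ) with hO
  have hsplit := Finset.card_filter_add_card_filter_not (s := O) fun s => s.card ≤ m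
  have hlong : (m + 1) * (O.filter fun s => ¬ s.card ≤ m).card ≤ Fintype.card V := by
    calc (m + 1) * (O.filter fun s => ¬ s.card ≤ m).card
        = ∑ _s ∈ O.filter fun s => ¬ s.card ≤ m, (m + 1) := by
          rw [Finset.sum_const, smul_eq_mul, mul_comm]
      _ ≤ ∑ s ∈ O.filter fun s => ¬ s.card ≤ m, s.card :=
          Finset.sum_le_sum fun s hs => by have := (Finset.mem_filter.1 hs).2; omega
      _ = ((O.filter fun s => ¬ s.card ≤ m).biUnion id).card := by
          rw [Finset.card_biUnion]
          · rfl
          intro s hs t ht hst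
          obtain ⟨v, -, rfl⟩ := Finset.mem_image.1 (Finset.mem_filter.1 hs).1
          obtain ⟨w, -, rfl⟩ := Finset.mem_image.1 (Finset.mem_filter.1 ht).1
          rw [Function.onFun, id, id, Finset.disjoint_left]
          intro x hx hx'
          exact hst (orbitFinset_eq_iff.2
            ((mem_orbitFinset.1 hx).trans (mem_orbitFinset.1 hx').symm))
      _ ≤ _ := Finset.card_le_univ _
  have h1 : ((m : ℝ) + 1) * (O.filter fun s => ¬ s.card ≤ m).card ≤ Fintype.card V := by
    exact_mod_cast hlong
  have h2 : ((O.filter fun s => ¬ s.card ≤ m).card : ℝ) ≤ Fintype.card V / (m + 1) := by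
    rw [le_div_iff₀ (by positivity)]; linarith
  have h3 : (O.card : ℝ) = (O.filter fun s => s.card ≤ m).card +
      (O.filter fun s => ¬ s.card ≤ m).card := by exact_mod_cast hsplit.symm
  have h4 : (shortOrbits σ Finset.univ m).card = (O.filter fun s => s.card ≤ m).card := rfl
  rw [h3, h4]
  linarith

end ShortCycles

/-! ### Most permutations have few cycles; the shape of the error term. -/

lemma tendsto_log_div_natCast :
    Tendsto (fun n : ℕ => Real.log n / n) atTop (𝓝 0) :=
  (Real.isLittleO_log_id_atTop.tendsto_div_nhds_zero).comp tendsto_natCast_atTop_atTop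

lemma sqrt_mul_log_eq (n : ℕ) :
    Real.sqrt (n * Real.log n) = n * Real.sqrt (Real.log n / n) := by
  rcases Nat.eq_zero_or_pos n with rfl | hn
  · simp
  have hn' : (0 : ℝ) < n := by exact_mod_cast hn
  rw [show (n : ℝ) * Real.log n = (n : ℝ) ^ 2 * (Real.log n / n) by field_simp,
    Real.sqrt_mul (by positivity), Real.sqrt_sq hn'.le]

lemma tendsto_sqrt_log_div :
    Tendsto (fun n : ℕ => Real.sqrt (Real.log n / n)) atTop (𝓝 0) := by
  have := (Real.continuous_sqrt.tendsto 0).comp tendsto_log_div_natCast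
  rwa [Real.sqrt_zero] at this

/-- The number of permutations with more than `√(n ln n)` cycles in a dense regular relation. -/
theorem eventually_half_le_card_fewCycles (α : ℝ) (hα : 0 < α) :
    ∀ᶠ n : ℕ in atTop, ∀ r : ℕ, α * n - 1 ≤ r → ∀ N : Fin n → Finset (Fin n),
      (∀ i, (N i).card = r) → (∀ j, (Finset.univ.filter fun i => j ∈ N i).card = r) →
      (r : ℝ) ^ n * Real.exp (-n) / 2 ≤
        ((permsOn N Finset.univ).filter fun σ =>
          (numCycles σ : ℝ) ≤ Real.sqrt (n * Real.log n)).card := by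
  have hlog : Tendsto (fun n : ℕ => Real.log n) atTop atTop :=
    Real.tendsto_log_atTop.comp tendsto_natCast_atTop_atTop
  have hsq := tendsto_sqrt_log_div
  filter_upwards [hlog.eventually_ge_atTop 1,
    hlog.eventually_ge_atTop (16 / α * Real.exp (40 / α + 1)),
    hsq.eventually_lt_const (show (0 : ℝ) < 1 / 8 by norm_num),
    hsq.eventually_lt_const (show (0 : ℝ) < α / 16 by positivity),
    tendsto_natCast_atTop_atTop.eventually_ge_atTop (2 / α),
    eventually_ge_atTop 2] with n hl1 hl2 hs1 hs2 hn1 hn2 r hr N hrow hcol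
  set l := Real.log n with hl
  set s := Real.sqrt (n * l) with hs
  have hn : (0 : ℝ) < n := by positivity
  have hn2' : (2 : ℝ) ≤ n := by exact_mod_cast hn2
  have hl0 : 0 < l := by linarith
  have hs0 : 0 < s := Real.sqrt_pos.2 (by positivity)
  have hss : s * s = n * l := Real.mul_self_sqrt (by positivity)
  have hsn : s = n * Real.sqrt (l / n) := sqrt_mul_log_eq n
  have hs_small : 4 * s ≤ α * n / 4 := by rw [hsn]; nlinarith
  have hs_log : 4 * (l + 1) ≤ s := by
    have h8 : 8 * s ≤ n := by rw [hsn]; nlinarith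
    have : 8 * l * s ≤ s * s := by rw [hss]; nlinarith
    nlinarith [le_of_mul_le_mul_right this hs0]
  have hαn : 2 ≤ α * n := by rw [div_le_iff₀ hα] at hn1; linarith
  have hr2 : α * n / 2 ≤ r := by linarith
  have hr0 : (0 : ℝ) < r := by linarith
  have hr0' : 0 < r := by exact_mod_cast hr0
  set J := ⌈l⌉₊ with hJ
  have hJ1 : l ≤ J := Nat.le_ceil l
  have hJ2 : (J : ℝ) ≤ l + 1 := (Nat.ceil_lt_add_one hl0.le).le
  -- With this threshold at most n/(m + 1) ≤ s/2 cycles are long.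
  set m := ⌊2 * n / s⌋₊ with hm
  have hm1 : (m : ℝ) ≤ 2 * n / s := Nat.floor_le (by positivity)
  have hm2 : 2 * n / s ≤ m + 1 := (Nat.lt_floor_add_one _).le
  set Q := Real.exp (40 / α * l - n) with hQ
  -- J peels remove at most 4s vertices. The 40/α in Q is 32/α from (4s)²/r plus 8/α from the
  -- Stirling error, by r ≥ αn/2 and r - 4s ≥ αn/4.
  have hbase : ∀ U : Finset (Fin n), Uᶜ.card ≤ J * m →
      ((permsOn N U).card : ℝ) ≤ Q * (r : ℝ) ^ U.card := by
    intro U hU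
    have hJm : (Uᶜ.card : ℝ) ≤ 4 * s := by
      calc (Uᶜ.card : ℝ) ≤ J * m := by exact_mod_cast hU
        _ ≤ (2 * l) * (2 * n / s) := by gcongr; linarith
        _ = 4 * (s * s) / s := by rw [hss]; ring
        _ = 4 * s := by field_simp
    refine (card_permsOn_le N hrow hcol U (4 * s) hJm (by linarith)).trans ?_
    rw [Fintype.card_fin]
    refine mul_le_mul_of_nonneg_right (Real.exp_le_exp.2 ?_) (by positivity)
    have h1 : (4 * s) ^ 2 / r ≤ 32 / α * l := by
      rw [div_le_iff₀ hr0]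
      calc (4 * s) ^ 2 = 16 * (s * s) := by ring
        _ = 32 / α * l * (α * n / 2) := by rw [hss]; field_simp; ring
        _ ≤ 32 / α * l * r := by gcongr
    have h2 : n * (1 + Real.log n) / (r - 4 * s) ≤ 8 / α * l := by
      rw [div_le_iff₀ (by linarith)]
      calc (n : ℝ) * (1 + Real.log n) ≤ n * (2 * l) := by gcongr; linarith
        _ = 8 / α * l * (α * n / 4) := by field_simp; ring
        _ ≤ 8 / α * l * (r - 4 * s) := by gcongr; linarith
    have h3 : 40 / α * l = 32 / α * l + 8 / α * l := by ring
    linarith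
  -- Starting from s/2 short orbits, J ≤ l + 1 ≤ s/4 peels always leave at least s/4 to choose from.
  have hbad := card_permsManyShort_le hr0' hrow m (s / 4) Q (by positivity) (by positivity) J
    hbase J 0 (by omega) Finset.univ (s / 2) (by simp) (by linarith)
  rw [Fintype.card_fin, Finset.card_univ, Fintype.card_fin] at hbad
  have ha : (n : ℝ) * m / (r * (s / 4)) ≤ Real.exp (-(40 / α + 1)) := by
    calc (n : ℝ) * m / (r * (s / 4)) ≤ n * (2 * n / s) / ((α * n / 2) * (s / 4)) := by gcongr
      _ = 16 * n / (α * (s * s)) := by field_simp; ring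
      _ = 16 / (α * l) := by rw [hss]; field_simp
      _ ≤ Real.exp (-(40 / α + 1)) := by
        rw [Real.exp_neg, div_le_iff₀ (by positivity), inv_mul_eq_div,
          le_div_iff₀ (Real.exp_pos _)]
        calc 16 * Real.exp (40 / α + 1) = α * (16 / α * Real.exp (40 / α + 1)) := by field_simp
          _ ≤ α * l := by gcongr
  have hbad' : ((permsManyShort N Finset.univ m (s / 2)).card : ℝ) ≤
      (r : ℝ) ^ n * Real.exp (-n) / 2 := by
    refine hbad.trans ?_
    -- Since J ≥ l, the peels cancel the loss e^(40l/α) in Q; the extra 1 in the exponent leaves the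
    -- factor e^(-l) = 1/n.
    have h1 : ((n : ℝ) * m / (r * (s / 4))) ^ J * Q ≤ Real.exp (-l) * Real.exp (-n) := by
      calc ((n : ℝ) * m / (r * (s / 4))) ^ J * Q
          ≤ Real.exp (-(40 / α + 1)) ^ J * Q := by gcongr
        _ = Real.exp (J * -(40 / α + 1)) * Q := by rw [Real.exp_nat_mul]
        _ ≤ Real.exp (l * -(40 / α + 1)) * Q := by
          refine mul_le_mul_of_nonneg_right (Real.exp_le_exp.2 ?_) (by positivity)
          have : 0 < 40 / α + 1 := by positivity
          nlinarith
        _ = Real.exp (-l) * Real.exp (-n) := by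
          rw [hQ, ← Real.exp_add, ← Real.exp_add]
          congr 1
          ring
    have h2 : Real.exp (-l) ≤ 1 / 2 := by
      rw [Real.exp_neg, hl, Real.exp_log hn, one_div]
      exact inv_anti₀ (by norm_num) hn2'
    calc _ ≤ Real.exp (-l) * Real.exp (-n) * (r : ℝ) ^ n :=
          mul_le_mul_of_nonneg_right h1 (by positivity)
      _ ≤ 1 / 2 * Real.exp (-n) * (r : ℝ) ^ n := by gcongr
      _ = _ := by ring
  have htotal : (r : ℝ) ^ n * Real.exp (-n) ≤ (permsOn N Finset.univ).card := by
    refine (pow_mul_exp_neg_le_card_perm hr0' N hrow hcol).trans (le_of_eq ?_)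
    congr 2
    ext σ
    simp [mem_permsOn]
  have hcover : (permsOn N Finset.univ).card ≤
      ((permsOn N Finset.univ).filter fun σ => (numCycles σ : ℝ) ≤ s).card +
        (permsManyShort N Finset.univ m (s / 2)).card := by
    classical
    rw [← Finset.card_filter_add_card_filter_not (s := permsOn N Finset.univ)
      fun σ => (numCycles σ : ℝ) ≤ s]
    gcongr
    intro σ hσ
    obtain ⟨h1, h2⟩ := Finset.mem_filter.1 hσ
    refine Finset.mem_filter.2 ⟨h1, ?_⟩
    have h3 := numOrbits_le_card_shortOrbits_add σ m
    rw [card_image_orbitFinset, Fintype.card_fin] at h3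
    have h4 : (n : ℝ) / (m + 1) ≤ s / 2 := by
      rw [div_le_iff₀ hs0] at hm2
      rw [div_le_iff₀ (by positivity)]
      linarith
    have h5 : s < ((Multiset.card σ.cycleType + (Finset.univ.filter fun i => σ i = i).card : ℕ) :
        ℝ) := not_le.1 h2
    linarith
  have hcover' : ((permsOn N Finset.univ).card : ℝ) ≤
      ((permsOn N Finset.univ).filter fun σ => (numCycles σ : ℝ) ≤ s).card +
        (permsManyShort N Finset.univ m (s / 2)).card := by exact_mod_cast hcover
  linarith

/-- The error in the exponent, per vertex. -/
noncomputable def exponentError (α : ℝ) (n : ℕ) : ℝ :=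
  2 / α * (n : ℝ)⁻¹ + 2 / α * ((n : ℝ)⁻¹ + Real.log n / n) +
    ((n : ℝ)⁻¹ + Real.sqrt (Real.log n / n))

lemma tendsto_exponentError (α : ℝ) : Tendsto (exponentError α) atTop (𝓝 0) := by
  have h1 : Tendsto (fun n : ℕ => (n : ℝ)⁻¹) atTop (𝓝 0) := tendsto_inv_atTop_nhds_zero_nat
  have := ((h1.const_mul (2 / α)).add ((h1.add tendsto_log_div_natCast).const_mul (2 / α))).add
    (h1.add tendsto_sqrt_log_div)
  simp only [add_zero, mul_zero] at this
  exact this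

/-- Turning bounds on a count, up to a subexponential factor, into the form
`(1 + o(1))ⁿ (α n / e)ⁿ`. -/
lemma exists_eq_one_add_pow_mul {α : ℝ} (hα : 0 < α) {n r c : ℕ} (hn : 2 ≤ α * n)
    (hr1 : α * n - 1 ≤ r) (hr2 : r ≤ α * n + 1)
    (hlow : Real.exp (-(1 + Real.sqrt (n * Real.log n))) * ((r : ℝ) ^ n * Real.exp (-n)) ≤ c)
    (hup : (c : ℝ) ≤ Real.exp (n * (1 + Real.log n) / r) * ((r : ℝ) ^ n * Real.exp (-n))) :
    ∃ x : ℝ, |x| ≤ Real.exp (exponentError α n) - 1 ∧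
      (c : ℝ) = (1 + x) ^ n * (α * n / Real.exp 1) ^ n := by
  have hn0 : (0 : ℝ) < n := by
    by_contra! h
    nlinarith
  have hD : 0 < α * n := by positivity
  have hr0 : (0 : ℝ) < r := by linarith
  have hlogn : 0 ≤ Real.log n := Real.log_natCast_nonneg n
  have hc : (0 : ℝ) < c := lt_of_lt_of_le (by positivity) hlow
  set y := Real.log c / n - (Real.log (α * n) - 1) with hy
  have hrn : (r : ℝ) ^ n * Real.exp (-n) = Real.exp (n * (Real.log r - 1)) := by
    rw [mul_sub, Real.exp_sub, ← Real.log_pow, Real.exp_log (by positivity), mul_one,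
      Real.exp_neg, div_eq_mul_inv]
  rw [hrn, ← Real.exp_add] at hlow hup
  have hlow' : -(1 + Real.sqrt (n * Real.log n)) + n * (Real.log r - 1) ≤ Real.log c :=
    (Real.le_log_iff_exp_le hc).2 hlow
  have hup' : Real.log c ≤ n * (1 + Real.log n) / r + n * (Real.log r - 1) :=
    (Real.log_le_iff_le_exp hc).2 hup
  have hratio : |Real.log r - Real.log (α * n)| ≤ 2 / (α * n) := by
    have h1 := Real.log_le_sub_one_of_pos (div_pos hr0 hD)
    have h2 := Real.log_le_sub_one_of_pos (div_pos hD hr0)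
    rw [Real.log_div hr0.ne' hD.ne', div_sub_one hD.ne'] at h1
    rw [Real.log_div hD.ne' hr0.ne', div_sub_one hr0.ne'] at h2
    have h3 : (r - α * n) / (α * n) ≤ 2 / (α * n) := by gcongr; linarith
    have h4 : (α * n - r) / r ≤ 2 / (α * n) := by
      rw [div_le_div_iff₀ hr0 hD]
      nlinarith
    exact abs_le.2 ⟨by linarith, by linarith⟩
  obtain ⟨hratio1, hratio2⟩ := abs_le.1 hratio
  -- The three summands pay for replacing r by αn, for the upper bound's error, and for the loss of
  -- 1 + √(n ln n) in the lower bound.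
  have hη : |y| ≤ exponentError α n := by
    have e1 : 2 / α * (n : ℝ)⁻¹ = 2 / (α * n) := by field_simp
    have e2 : 2 / α * ((n : ℝ)⁻¹ + Real.log n / n) = (1 + Real.log n) / (α * n / 2) := by
      field_simp
    have e3 : (n : ℝ)⁻¹ + Real.sqrt (Real.log n / n) =
        (1 + Real.sqrt (n * Real.log n)) / n := by
      rw [sqrt_mul_log_eq]; field_simp
    have p2 : 0 ≤ (1 + Real.log n) / (α * n / 2) := by positivity
    have p3 : 0 ≤ (1 + Real.sqrt (n * Real.log n)) / n := by positivity
    have u : Real.log c / n ≤ (1 + Real.log n) / (α * n / 2) + (Real.log r - 1) := by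
      rw [div_le_iff₀ hn0]
      have : n * (1 + Real.log n) / r ≤ n * (1 + Real.log n) / (α * n / 2) := by
        gcongr; linarith
      calc _ ≤ _ := hup'
        _ ≤ n * (1 + Real.log n) / (α * n / 2) + n * (Real.log r - 1) := by linarith
        _ = _ := by ring
    have v : -((1 + Real.sqrt (n * Real.log n)) / n) + (Real.log r - 1) ≤ Real.log c / n := by
      rw [le_div_iff₀ hn0]
      calc _ = -(1 + Real.sqrt (n * Real.log n)) + n * (Real.log r - 1) := by field_simp
        _ ≤ _ := hlow'
    rw [exponentError, e1, e2, e3]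
    exact abs_le.2 ⟨by linarith, by linarith⟩
  obtain ⟨hη1, hη2⟩ := abs_le.1 hη
  refine ⟨Real.exp y - 1, abs_le.2 ⟨?_, ?_⟩, ?_⟩
  · have h1 := Real.exp_le_exp.2 hη1
    -- This lets the upper deviation e^η - 1 serve as a bound for the lower one, 1 - e^(-η).
    have h2 : 2 ≤ Real.exp (exponentError α n) + Real.exp (-exponentError α n) := by
      linarith [Real.add_one_le_exp (exponentError α n),
        Real.add_one_le_exp (-exponentError α n)]
    linarith
  · linarith [Real.exp_le_exp.2 hη2]
  · rw [add_sub_cancel, ← mul_pow]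
    have : Real.exp y * (α * n / Real.exp 1) = Real.exp (Real.log c / n) := by
      rw [hy, Real.exp_sub, Real.exp_sub, Real.exp_log hD]
      field_simp
    rw [this, ← Real.exp_nat_mul, mul_div_cancel₀ _ hn0.ne', Real.exp_log hc]

lemma tendsto_exp_exponentError_sub_one (α : ℝ) :
    Tendsto (fun n => Real.exp (exponentError α n) - 1) atTop (𝓝 0) := by
  have := ((Real.continuous_exp.tendsto 0).comp (tendsto_exponentError α)).sub_const 1
  simpa using this

/-! ### Permutations and 2-factors. -/

section PermGraph

variable {V : Type}

/-- The graph whose edges join `v` and `σ v`. -/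
def permGraph (σ : Equiv.Perm V) : SimpleGraph V := SimpleGraph.fromRel fun v w => σ v = w

lemma permGraph_adj {σ : Equiv.Perm V} {v w : V} :
    (permGraph σ).Adj v w ↔ v ≠ w ∧ (σ v = w ∨ σ w = v) := SimpleGraph.fromRel_adj _ _ _

variable [Fintype V] [DecidableEq V]

lemma permGraph_reachable_iff {σ : Equiv.Perm V} {v w : V} :
    (permGraph σ).Reachable v w ↔ σ.SameCycle v w := by
  constructor
  · rintro ⟨p⟩
    induction p with
    | nil => exact .refl _ _
    | cons h _ ih =>
      refine Equiv.Perm.SameCycle.trans ?_ ih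
      rcases (permGraph_adj.1 h).2 with h | h
      · exact ⟨1, by simpa using h⟩
      · exact Equiv.Perm.SameCycle.symm ⟨1, by simpa using h⟩
  · intro h
    obtain ⟨t, -, rfl⟩ := sameCycle_iff_exists_iterate.1 h
    clear h
    induction t with
    | zero => exact .refl _
    | succ t ih =>
      rw [Function.iterate_succ_apply']
      refine ih.trans ?_
      by_cases h : σ^[t] v = σ (σ^[t] v)
      · rw [← h]
      · exact SimpleGraph.Adj.reachable (permGraph_adj.2 ⟨h, Or.inl rfl⟩)

lemma natCard_connectedComponent_permGraph (σ : Equiv.Perm V) :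
    Nat.card (permGraph σ).ConnectedComponent = (Finset.univ.image (orbitFinset σ)).card := by
  let g : (permGraph σ).ConnectedComponent → Finset V :=
    Quot.lift (orbitFinset σ) fun v w h => orbitFinset_eq_iff.2 (permGraph_reachable_iff.1 h)
  have hg : Function.Injective g := by
    intro C D
    induction C using SimpleGraph.ConnectedComponent.ind with | _ v
    induction D using SimpleGraph.ConnectedComponent.ind with | _ w
    intro h
    exact SimpleGraph.ConnectedComponent.eq.2
      (permGraph_reachable_iff.2 (orbitFinset_eq_iff.1 h))
  have hrange : Set.range g = (Finset.univ.image (orbitFinset σ) : Finset (Finset V)) := by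
    ext s
    simp only [Set.mem_range, Finset.coe_image, Finset.coe_univ, Set.image_univ]
    constructor
    · rintro ⟨C, rfl⟩
      induction C using SimpleGraph.ConnectedComponent.ind with | _ v
      exact ⟨v, rfl⟩
    · rintro ⟨v, rfl⟩
      exact ⟨(permGraph σ).connectedComponentMk v, rfl⟩
  rw [← Set.ncard_coe_finset, ← hrange, ← Set.image_univ, Set.ncard_image_of_injective _ hg,
    Set.ncard_univ]

/-- The form q + 2 includes the single edge, where both alternatives coincide. -/
lemma cycleGraph_adj_add_two {q : ℕ} {a b : Fin (q + 2)} :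
    (SimpleGraph.cycleGraph (q + 2)).Adj a b ↔ b = a + 1 ∨ a = b + 1 := by
  rw [SimpleGraph.cycleGraph_adj, sub_eq_iff_eq_add, sub_eq_iff_eq_add, add_comm 1, add_comm 1,
    or_comm]

/-- The components of the graph of a fixed-point-free permutation are cycles. -/
lemma nonempty_iso_cycleGraph_permGraph {σ : Equiv.Perm V} (hσ : ∀ v, σ v ≠ v)
    (C : (permGraph σ).ConnectedComponent) :
    ∃ k : ℕ, 2 ≤ k ∧ Nonempty (C.toSimpleGraph ≃g SimpleGraph.cycleGraph k) := by
  induction C using SimpleGraph.ConnectedComponent.ind with | _ v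
  have h2 : 2 ≤ Function.minimalPeriod σ v := by
    have h0 := minimalPeriod_perm_pos σ v
    have h1 : Function.minimalPeriod σ v ≠ 1 := fun h =>
      hσ v (Function.minimalPeriod_eq_one_iff_isFixedPt.1 h)
    omega
  obtain ⟨q, hq⟩ : ∃ q, Function.minimalPeriod σ v = q + 2 := ⟨_, (Nat.sub_add_cancel h2).symm⟩
  refine ⟨q + 2, by omega, ⟨SimpleGraph.Iso.symm ?_⟩⟩
  have hmem : ∀ w, w ∈ ((permGraph σ).connectedComponentMk v).supp ↔ σ.SameCycle v w := fun w => by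
    rw [SimpleGraph.ConnectedComponent.mem_supp_iff, SimpleGraph.ConnectedComponent.eq,
      permGraph_reachable_iff, Equiv.Perm.sameCycle_comm]
  let e : Fin (q + 2) → ((permGraph σ).connectedComponentMk v).supp := fun t =>
    ⟨σ^[t] v, (hmem _).2 (sameCycle_iff_exists_iterate.2 ⟨t, t.2.trans_eq hq.symm, rfl⟩)⟩
  have he : Function.Bijective e := by
    constructor
    · intro s t h
      refine Fin.ext (Function.iterate_injOn_Iio_minimalPeriod (f := σ) (x := v) ?_ ?_
        (congrArg Subtype.val h))
      · rw [Set.mem_Iio, hq]; exact s.2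
      · rw [Set.mem_Iio, hq]; exact t.2
    · rintro ⟨w, hw⟩
      obtain ⟨t, ht, rfl⟩ := sameCycle_iff_exists_iterate.1 ((hmem w).1 hw)
      exact ⟨⟨t, hq ▸ ht⟩, rfl⟩
  have hstep : ∀ a : Fin (q + 2), σ (e a) = e (a + 1) := by
    intro a
    change σ (σ^[a] v) = σ^[(a + 1 : Fin (q + 2))] v
    have hmod := Function.iterate_mod_minimalPeriod_eq (f := σ) (x := v) (n := (a : ℕ) + 1)
    rw [hq] at hmod
    rw [← Function.iterate_succ_apply' (f := σ), Fin.val_add, Fin.val_one, hmod]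
  refine ⟨Equiv.ofBijective e he, ?_⟩
  intro a b
  have hval : ∀ {c d : Fin (q + 2)}, (e c : V) = e d ↔ c = d := fun {c d} => by
    rw [← Subtype.ext_iff, he.1.eq_iff]
  change (permGraph σ).Adj (e a) (e b) ↔ _
  rw [permGraph_adj, cycleGraph_adj_add_two, hstep, hstep, hval, Ne, hval, hval]
  constructor
  · rintro ⟨-, h | h⟩
    · exact Or.inl h.symm
    · exact Or.inr h.symm
  · intro h
    refine ⟨?_, h.imp Eq.symm Eq.symm⟩
    rintro rfl
    rcases h with h | h <;> simp at h

/-- A graph whose components are cycles is the graph of a permutation. -/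
lemma exists_perm_of_components_cycles {F : SimpleGraph V}
    (hF : ∀ C : F.ConnectedComponent,
      ∃ k : ℕ, 2 ≤ k ∧ Nonempty (C.toSimpleGraph ≃g SimpleGraph.cycleGraph k)) :
    ∃ σ : Equiv.Perm V, (∀ v, F.Adj v (σ v)) ∧ permGraph σ = F := by
  have hF' : ∀ C : F.ConnectedComponent,
      ∃ q : ℕ, Nonempty (C.toSimpleGraph ≃g SimpleGraph.cycleGraph (q + 2)) := fun C => by
    obtain ⟨k, hk, h⟩ := hF C
    exact ⟨k - 2, by rwa [Nat.sub_add_cancel hk]⟩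
  choose q hq using hF'
  let φ := fun C => (hq C).some
  -- Rotate each component by one step in a chosen cyclic labelling; on a single edge this is the
  -- swap.
  let f : V → V := fun v =>
    ((φ (F.connectedComponentMk v)).symm (φ (F.connectedComponentMk v) ⟨v, rfl⟩ + 1)).1
  have hf : ∀ (C : F.ConnectedComponent) (v : V) (hv : v ∈ C.supp),
      f v = ((φ C).symm (φ C ⟨v, hv⟩ + 1)).1 := by
    intro C v hv
    have : F.connectedComponentMk v = C := hv
    subst this
    rfl
  have hfC : ∀ (C : F.ConnectedComponent) (v : V), v ∈ C.supp → f v ∈ C.supp := by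
    intro C v hv
    rw [hf C v hv]
    exact Subtype.prop _
  have hφf : ∀ (C : F.ConnectedComponent) (v : V) (hv : v ∈ C.supp),
      φ C ⟨f v, hfC C v hv⟩ = φ C ⟨v, hv⟩ + 1 := by
    intro C v hv
    have : (⟨f v, hfC C v hv⟩ : C.supp) = (φ C).symm (φ C ⟨v, hv⟩ + 1) := Subtype.ext (hf C v hv)
    rw [this]
    exact (φ C).apply_symm_apply _
  have hadj : ∀ (C : F.ConnectedComponent) (v w : V) (hv : v ∈ C.supp) (hw : w ∈ C.supp),
      F.Adj v w ↔ f v = w ∨ f w = v := by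
    intro C v w hv hw
    have h1 : F.Adj v w ↔ (SimpleGraph.cycleGraph (q C + 2)).Adj (φ C ⟨v, hv⟩) (φ C ⟨w, hw⟩) :=
      ((φ C).map_adj_iff (v := ⟨v, hv⟩) (w := ⟨w, hw⟩)).symm
    rw [h1, cycleGraph_adj_add_two, ← hφf, ← hφf, (φ C).injective.eq_iff, (φ C).injective.eq_iff,
      Subtype.mk.injEq, Subtype.mk.injEq, eq_comm, eq_comm (a := v)]
  have hcomp : ∀ v, v ∈ (F.connectedComponentMk v).supp := fun v => rfl
  have hinj : Function.Injective f := by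
    intro v w h
    have hv := hcomp v
    have hw : w ∈ (F.connectedComponentMk v).supp := by
      have h1 : F.connectedComponentMk (f v) = F.connectedComponentMk v := hfC _ v (hcomp v)
      have h2 : F.connectedComponentMk (f w) = F.connectedComponentMk w := hfC _ w (hcomp w)
      change F.connectedComponentMk w = F.connectedComponentMk v
      rw [← h1, ← h2, h]
    have h3 := hφf _ v hv
    have h4 := hφf _ w hw
    have h5 : (⟨f v, hfC _ v hv⟩ : (F.connectedComponentMk v).supp) = ⟨f w, hfC _ w hw⟩ :=
      Subtype.ext h
    rw [h5, h4] at h3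
    have h6 := (φ _).injective (add_right_cancel h3)
    exact (Subtype.mk.injEq _ _ _ _ ▸ h6).symm
  have hfadj : ∀ v, F.Adj v (f v) := fun v =>
    (hadj _ v (f v) (hcomp v) (hfC _ v (hcomp v))).2 (Or.inl rfl)
  refine ⟨Equiv.ofBijective f (Finite.injective_iff_bijective.1 hinj), hfadj, ?_⟩
  ext v w
  rw [permGraph_adj]
  change (v ≠ w ∧ (f v = w ∨ f w = v)) ↔ _
  constructor
  · rintro ⟨-, rfl | rfl⟩
    · exact hfadj v
    · exact (hfadj w).symm
  · intro h
    have hw : w ∈ (F.connectedComponentMk v).supp :=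
      (SimpleGraph.ConnectedComponent.eq.2 h.reachable).symm
    exact ⟨h.ne, (hadj _ v w (hcomp v) hw).1 h⟩

/-- A graph with `c` components comes from at most `2 ^ c` fixed-point-free permutations. -/
lemma card_perm_of_permGraph_eq_le (F : SimpleGraph V) (S : Finset (Equiv.Perm V))
    (hS : ∀ σ ∈ S, (∀ v, σ v ≠ v) ∧ permGraph σ = F) :
    S.card ≤ 2 ^ Nat.card F.ConnectedComponent := by
  classical
  rcases S.eq_empty_or_nonempty with rfl | ⟨σ₀, hσ₀⟩
  · simp
  have hnb : ∀ σ ∈ S, ∀ τ ∈ S, ∀ v, τ v = σ v ∨ σ (τ v) = v := by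
    intro σ hσ τ hτ v
    have h1 : (permGraph τ).Adj v (τ v) := permGraph_adj.2 ⟨((hS τ hτ).1 v).symm, Or.inl rfl⟩
    rw [(hS τ hτ).2, ← (hS σ hσ).2] at h1
    exact (permGraph_adj.1 h1).2.imp Eq.symm id
  -- Agreement at one vertex fixes the direction of travel and so propagates along the whole cycle.
  have hdet : ∀ σ ∈ S, ∀ τ ∈ S, ∀ v, σ v = τ v → ∀ w, σ.SameCycle v w → σ w = τ w := by
    intro σ hσ τ hτ v hv w hw
    obtain ⟨t, -, rfl⟩ := sameCycle_iff_exists_iterate.1 hw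
    clear hw
    induction t with
    | zero => exact hv
    | succ t ih =>
      rw [Function.iterate_succ_apply']
      set x := σ^[t] v
      rcases hnb τ hτ σ hσ (σ x) with h | h
      · exact h
      -- If each value at σ x is also the other permutation's predecessor of σ x, both equal x, and
      -- the two agree there after all.
      · rcases hnb σ hσ τ hτ (σ x) with h' | h'
        · exact h'.symm
        · have h1 : τ (σ x) = x := σ.injective h'
          have h2 : σ (σ x) = x := τ.injective (h.trans ih)
          rw [h1, h2]
  -- One bit per component: its direction relative to the reference σ₀.
  let g : Equiv.Perm V → F.ConnectedComponent → Bool := fun σ C => decide (σ C.out = σ₀ C.out)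
  have hg : Set.InjOn g S := by
    intro σ hσ τ hτ h
    ext w
    have hC := congrFun h (F.connectedComponentMk w)
    simp only [g, decide_eq_decide] at hC
    set v := (F.connectedComponentMk w).out with hv
    have hvw : σ.SameCycle v w := by
      rw [← permGraph_reachable_iff, (hS σ hσ).2]
      exact SimpleGraph.ConnectedComponent.exact (Quot.out_eq _)
    refine hdet σ hσ τ hτ v ?_ w hvw
    by_cases h1 : σ v = σ₀ v
    · rw [h1, hC.1 h1]
    · have h2 : ¬ τ v = σ₀ v := fun h' => h1 (hC.2 h')
      have h3 := (hnb σ₀ hσ₀ σ hσ v).resolve_left h1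
      have h4 := (hnb σ₀ hσ₀ τ hτ v).resolve_left h2
      exact σ₀.injective (h3.trans h4.symm)
  have : Fintype F.ConnectedComponent := Fintype.ofFinite _
  calc S.card = (S.image g).card := (Finset.card_image_of_injOn hg).symm
    _ ≤ Fintype.card (F.ConnectedComponent → Bool) := Finset.card_le_univ _
    _ = _ := by simp [Nat.card_eq_fintype_card]

end PermGraph

/-! ### Both counts assembled. -/

lemma containsPerm_iff {n : ℕ} {A : Matrix (Fin n) (Fin n) ℝ}
    (hA : ∀ i j, A i j = 0 ∨ A i j = 1) (σ : Equiv.Perm (Fin n)) :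
    ContainsPerm A σ ↔ ∀ i, A i (σ i) = 1 := by
  have hP : ∀ i j, (σ.permMatrix ℝ) i j = if σ i = j then 1 else 0 := fun i j => by
    simp [Equiv.Perm.permMatrix, PEquiv.toMatrix_apply, Equiv.toPEquiv_apply, eq_comm]
  constructor
  · intro h i
    have := h i (σ i)
    rw [hP, if_pos rfl] at this
    rcases hA i (σ i) with h' | h'
    · linarith
    · exact h'
  · intro h i j
    rw [hP]
    split_ifs with hij
    · rw [← hij, h]
    · rcases hA i j with h' | h' <;> rw [h']
      exact zero_le_one

lemma card_permsOn_univ_le {n r : ℕ} (hr : 0 < r) (N : Fin n → Finset (Fin n))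
    (hrow : ∀ i, (N i).card = r) (hcol : ∀ j, (Finset.univ.filter fun i => j ∈ N i).card = r) :
    ((permsOn N Finset.univ).card : ℝ) ≤
      Real.exp (n * (1 + Real.log n) / r) * ((r : ℝ) ^ n * Real.exp (-n)) := by
  have h := card_permsOn_le N hrow hcol Finset.univ 0 (by simp) (by exact_mod_cast hr)
  rw [Fintype.card_fin, Finset.card_univ, Fintype.card_fin] at h
  refine h.trans (le_of_eq ?_)
  rw [zero_pow two_ne_zero, zero_div, zero_add, sub_zero, sub_eq_add_neg, Real.exp_add]
  ring

lemma isTwoFactor_permGraph {n : ℕ} {G : SimpleGraph (Fin n)} {σ : Equiv.Perm (Fin n)}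
    (h : ∀ v, G.Adj v (σ v)) : IsTwoFactor G (permGraph σ) := by
  refine ⟨fun v w hvw => ?_, nonempty_iso_cycleGraph_permGraph fun v => (h v).ne'⟩
  rcases (permGraph_adj.1 hvw).2 with rfl | rfl
  · exact h v
  · exact (h w).symm

lemma natCard_connectedComponent_eq_numCycles {n : ℕ} (σ : Equiv.Perm (Fin n)) :
    Nat.card (permGraph σ).ConnectedComponent = numCycles σ :=
  (natCard_connectedComponent_permGraph σ).trans (card_image_orbitFinset σ)

lemma numTwoFactorsFewCycles_le {n : ℕ} (G : SimpleGraph (Fin n)) [DecidableRel G.Adj] (s : ℝ) :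
    numTwoFactorsFewCycles G s ≤
      (permsOn (fun v => G.neighborFinset v) Finset.univ).card := by
  classical
  rw [numTwoFactorsFewCycles, ← Set.ncard_coe_finset]
  refine (Set.ncard_le_ncard ?_ (Set.toFinite _)).trans
    (Set.ncard_image_le (f := permGraph) (Set.toFinite _))
  rintro F ⟨⟨hFG, hF⟩, -⟩
  obtain ⟨σ, hσ, rfl⟩ := exists_perm_of_components_cycles hF
  exact ⟨σ, by simpa [mem_permsOn] using fun v => hFG (hσ v), rfl⟩

/-- Group the permutations by the 2-factor they trace: each fibre has at most 2^c ≤ e^s members, c ≤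
s being the number of cycles. -/
lemma card_permsFewCycles_le {n : ℕ} (G : SimpleGraph (Fin n)) [DecidableRel G.Adj] (s : ℝ) :
    (((permsOn (fun v => G.neighborFinset v) Finset.univ).filter fun σ =>
      (numCycles σ : ℝ) ≤ s).card : ℝ) ≤ Real.exp s * numTwoFactorsFewCycles G s := by
  classical
  set S := (permsOn (fun v => G.neighborFinset v) Finset.univ).filter fun σ =>
      (numCycles σ : ℝ) ≤ s with hS
  set T := Finset.univ.filter fun F : SimpleGraph (Fin n) =>
    IsTwoFactor G F ∧ (Nat.card F.ConnectedComponent : ℝ) ≤ s with hT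
  have hcardT : numTwoFactorsFewCycles G s = T.card := by
    rw [numTwoFactorsFewCycles, ← Set.ncard_coe_finset, hT]
    congr 1
    ext F
    simp
  have hadj : ∀ σ ∈ S, ∀ v, G.Adj v (σ v) := fun σ hσ v => by
    simpa using (mem_permsOn.1 (Finset.mem_filter.1 hσ).1).1 v (Finset.mem_univ v)
  have hmaps : ∀ σ ∈ S, permGraph σ ∈ T := fun σ hσ =>
    Finset.mem_filter.2 ⟨Finset.mem_univ _, isTwoFactor_permGraph (hadj σ hσ), by
      rw [natCard_connectedComponent_eq_numCycles]; exact (Finset.mem_filter.1 hσ).2⟩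
  rw [Finset.card_eq_sum_card_fiberwise hmaps, hcardT]
  push_cast
  calc _ ≤ ∑ _F ∈ T, Real.exp s := by
        refine Finset.sum_le_sum fun F hF => ?_
        have h1 := card_perm_of_permGraph_eq_le F (S.filter fun σ => permGraph σ = F)
          fun σ hσ => ⟨fun v => (hadj σ (Finset.mem_filter.1 hσ).1 v).ne',
            (Finset.mem_filter.1 hσ).2⟩
        calc ((S.filter fun σ => permGraph σ = F).card : ℝ)
            ≤ 2 ^ Nat.card F.ConnectedComponent := by exact_mod_cast h1
          _ ≤ Real.exp 1 ^ Nat.card F.ConnectedComponent := by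
            gcongr
            linarith [Real.add_one_le_exp (1 : ℝ)]
          _ = Real.exp (Nat.card F.ConnectedComponent) := by rw [← Real.exp_nat_mul, mul_one]
          _ ≤ Real.exp s := Real.exp_le_exp.2 (Finset.mem_filter.1 hF).2.2
    _ = _ := by rw [Finset.sum_const, nsmul_eq_mul, mul_comm]

lemma exp_neg_one_le_half : Real.exp (-1) ≤ 1 / 2 := by
  rw [Real.exp_neg, one_div]
  exact inv_anti₀ (by norm_num) (by linarith [Real.add_one_le_exp (1 : ℝ)])

lemma numPermsFewCycles_eq_card {n : ℕ} {A : Matrix (Fin n) (Fin n) ℝ}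
    (hA : ∀ i j, A i j = 0 ∨ A i j = 1) (N : Fin n → Finset (Fin n))
    (hN : ∀ i j, j ∈ N i ↔ A i j = 1) (s : ℝ) :
    numPermsFewCycles A s =
      ((permsOn N Finset.univ).filter fun σ => (numCycles σ : ℝ) ≤ s).card := by
  rw [numPermsFewCycles, ← Set.ncard_coe_finset]
  congr 1
  ext σ
  simp [mem_permsOn, containsPerm_iff hA, hN]

theorem lemma2p7 (α : ℝ) (hα : 0 < α) :
    (∃ δ : ℕ → ℝ, Tendsto δ atTop (𝓝 0) ∧ ∀ᶠ n : ℕ in atTop,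
      ∀ r : ℕ, (r = ⌊α * n⌋₊ ∨ r = ⌈α * n⌉₊) →
      ∀ A : Matrix (Fin n) (Fin n) ℝ, IsRegularZeroOne A r →
        ∃ x : ℝ, |x| ≤ δ n ∧
          (numPermsFewCycles A (Real.sqrt (n * Real.log n)) : ℝ)
            = (1 + x) ^ n * (α * n / Real.exp 1) ^ n) ∧
    (∃ δ : ℕ → ℝ, Tendsto δ atTop (𝓝 0) ∧ ∀ᶠ n : ℕ in atTop,
      ∀ r : ℕ, (r = ⌊α * n⌋₊ ∨ r = ⌈α * n⌉₊) →
      ∀ (G : SimpleGraph (Fin n)) [DecidableRel G.Adj], G.IsRegularOfDegree r →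
        ∃ x : ℝ, |x| ≤ δ n ∧
          (numTwoFactorsFewCycles G (Real.sqrt (n * Real.log n)) : ℝ)
            = (1 + x) ^ n * (α * n / Real.exp 1) ^ n) := by
  classical
  have hround : ∀ n r : ℕ, (r = ⌊α * n⌋₊ ∨ r = ⌈α * n⌉₊) →
      α * n - 1 ≤ r ∧ (r : ℝ) ≤ α * n + 1 := by
    intro n r hr
    have h0 : 0 ≤ α * n := by positivity
    rcases hr with rfl | rfl
    · exact ⟨(Nat.sub_one_lt_floor _).le, by linarith [Nat.floor_le h0]⟩
    · exact ⟨by linarith [Nat.le_ceil (α * n)], (Nat.ceil_lt_add_one h0).le⟩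
  have hlarge : ∀ᶠ n : ℕ in atTop, 2 ≤ α * n := by
    filter_upwards [tendsto_natCast_atTop_atTop.eventually_ge_atTop (2 / α)] with n hn
    rw [div_le_iff₀ hα] at hn
    linarith
  refine ⟨⟨_, tendsto_exp_exponentError_sub_one α, ?_⟩,
    ⟨_, tendsto_exp_exponentError_sub_one α, ?_⟩⟩
  · filter_upwards [eventually_half_le_card_fewCycles α hα, hlarge] with n hn hlarge r hr A hA
    obtain ⟨hr1, hr2⟩ := hround n r hr
    have hr0 : 0 < r := by
      have : (0 : ℝ) < r := by linarith
      exact_mod_cast this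
    set N : Fin n → Finset (Fin n) := fun i => Finset.univ.filter fun j => A i j = 1 with hN
    have hrow : ∀ i, (N i).card = r := fun i => by
      rw [← hA.2.1 i, ← Set.ncard_coe_finset]
      simp [hN]
    have hcol : ∀ j, (Finset.univ.filter fun i => j ∈ N i).card = r := fun j => by
      rw [← hA.2.2 j, ← Set.ncard_coe_finset]
      simp [hN]
    have hcount := numPermsFewCycles_eq_card hA.1 N (by simp [hN]) (Real.sqrt (n * Real.log n))
    refine exists_eq_one_add_pow_mul hα hlarge hr1 hr2 ?_ ?_
    · rw [hcount]
      refine le_trans ?_ (hn r hr1 N hrow hcol)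
      rw [div_eq_inv_mul, ← one_div]
      refine mul_le_mul_of_nonneg_right (le_trans (Real.exp_le_exp.2 ?_) exp_neg_one_le_half)
        (by positivity)
      linarith [Real.sqrt_nonneg (n * Real.log n)]
    · rw [hcount]
      exact (Nat.cast_le.2 (Finset.card_filter_le _ _)).trans
        (card_permsOn_univ_le hr0 N hrow hcol)
  · filter_upwards [eventually_half_le_card_fewCycles α hα, hlarge] with n hn hlarge r hr G _ hG
    obtain ⟨hr1, hr2⟩ := hround n r hr
    have hr0 : 0 < r := by
      have : (0 : ℝ) < r := by linarith
      exact_mod_cast this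
    have hrow : ∀ v, (G.neighborFinset v).card = r := fun v => hG v
    have hcol : ∀ w, (Finset.univ.filter fun v => w ∈ G.neighborFinset v).card = r := fun w => by
      rw [← hrow w]
      congr 1
      ext v
      simp [G.adj_comm]
    refine exists_eq_one_add_pow_mul hα hlarge hr1 hr2 ?_ ?_
    · set s := Real.sqrt (n * Real.log n)
      have h1 := (hn r hr1 _ hrow hcol).trans (card_permsFewCycles_le G s)
      -- The factor e^(-1) absorbs the lost half, and e^(-s) the orientations of the cycles.
      rw [neg_add, Real.exp_add, mul_assoc]
      calc Real.exp (-1) * (Real.exp (-s) * ((r : ℝ) ^ n * Real.exp (-n)))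
          ≤ 1 / 2 * (Real.exp (-s) * ((r : ℝ) ^ n * Real.exp (-n))) :=
            mul_le_mul_of_nonneg_right exp_neg_one_le_half (by positivity)
        _ = Real.exp (-s) * ((r : ℝ) ^ n * Real.exp (-n) / 2) := by ring
        _ ≤ Real.exp (-s) * (Real.exp s * numTwoFactorsFewCycles G s) :=
            mul_le_mul_of_nonneg_left h1 (by positivity)
        _ = numTwoFactorsFewCycles G s := by
            rw [← mul_assoc, ← Real.exp_add, neg_add_cancel, Real.exp_zero, one_mul]
    · exact (Nat.cast_le.2 (numTwoFactorsFewCycles_le G _)).trans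
        (card_permsOn_univ_le hr0 _ hrow hcol)
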